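/- **Theorem.** *Setting.* A motion on $[0,T]$ consists of finitely many points $P(t)=\{p_1(t),\dots,p_n(t)\}\subset\mathbb{R}^2$; assume that every point moves with at most unit speed and that the diameter $D(t)$ of $P(t)$ is at least $1$ for all $t\in[0,T]$. Orientations are elements of the real projective line, i.e. angles modulo $\pi$, and $|\beta-\alpha|$ is the smaller angle between two orientations. Write $w_\alpha(P)=\max_{p,q\in P}(p-q)\cdot\alpha$ for the extent of $P$ along orientation $\alpha$ and $\alpha^\perp$ for the orthogonal orientation, and let $$f_{\mathrm{obb}}(\alpha,P)=w_\alpha(P)\,w_{\alpha^\perp}(P),\qquad f_{\mathrm{strip}}(\alpha,P)=w_{\alpha^\perp}(P)$$ be the costs of the oriented bounding box and of the covering strip. An algorithm $\mathcal A$ is state-aware but not clairvoyant: its output $\mathcal A(P(t))$, an orientation, depends only on the motion up to time $t$. It is $K$-Lipschitz if its output rotates by at most $K$ radians per time unit. Its ratio for $\Pi\in\{\mathrm{obb},\mathrm{strip}\}$ is $$\sup_{P}\ \sup_{t\in[0,T]}\ \frac{f_\Pi(\mathcal A(P(t)),P(t))}{\min_\gamma f_\Pi(\gamma,P(t))}$$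 (over all motions as above and all $n$, $T$; a positive number divided by $0$ is $\infty$, and $0/0$ imposes no condition), and the $K$-Lipschitz stability ratio $\rho_{LS}(\Pi,K)$ is the infimum of the ratios of all $K$-Lipschitz algorithms. For a diametrical pair with orientation $\alpha$ let $z=w_{\alpha^\perp}(P)/D$ be the aspect ratio of the diametric box. *Claim.* There is a single $43$-Lipschitz algorithm, with output $\beta(t)$, that chases the orientation of the diametrical pair at speed $43$: $\beta(0)$ is the orientation of a diametrical pair of $P(0)$, and at almost every time $t$ there is a diametrical pair, with orientation $\alpha$ and aspect ratio $z$, such that $\beta(t)=\alpha$ or $\beta$ rotates towards $\alpha$ at speed exactly $43$, along the shorter arc if $8\arcsin z<\pi/2$, and in a direction that the algorithm may choose if $8\arcsin z\ge\pi/2$. It satisfies $|\beta(t)-\alpha|\le 8\arcsin(z)$ at all times, for every diametrical pair of $P(t)$, and its ratio is at most $18$ both for the oriented bounding box and for the covering strip. In particular $$\rho_{LS}(\mathrm{obb},43)\le 18\quad\text{and}\quad \rho_{LS}(\mathrm{strip},43)\le 18.$$ -/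

import Mathlib

open scoped ENNReal NNReal

noncomputable section

namespace OrientationStability

/-- The Euclidean plane. -/
abbrev Plane : Type := EuclideanSpace ℝ (Fin 2)

/-- The space of orientations (the real projective line), measured in radians: angles modulo `π`,
with the metric in which the distance of two orientations is the smaller angle between them. -/
abbrev Orientation : Type := AddCircle Real.pi

/-- The unit vector with angle `θ`. -/
def dir (θ : ℝ) : Plane := !₂[Real.cos θ, Real.sin θ]

/-- The extent `max_{i,j} (p i - p j) · u` of a point set along the unit vector `u` of angle `θ`. -/
def extentAngle {n : ℕ} (p : Fin n → Plane) (θ : ℝ) : ℝ :=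
  ⨆ ij : Fin n × Fin n, inner ℝ (p ij.1 - p ij.2) (dir θ)

/-- Opposite unit vectors give the same extent. -/
theorem extentAngle_periodic {n : ℕ} (p : Fin n → Plane) :
    Function.Periodic (extentAngle p) Real.pi := by
  intro θ
  have hd : dir (θ + Real.pi) = - dir θ := by
    ext i
    fin_cases i <;> simp [dir]
  unfold extentAngle
  refine Equiv.iSup_congr (Equiv.prodComm (Fin n) (Fin n)) ?_
  rintro ⟨i, j⟩
  rw [hd, inner_neg_right, ← inner_neg_left]
  simp

/-- The extent of a point set along an orientation. -/
def extent {n : ℕ} (α : Orientation) (p : Fin n → Plane) : ℝ :=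
  (extentAngle_periodic p).lift α

/-- The orientation orthogonal to `α`. -/
def perp (α : Orientation) : Orientation := α + ((Real.pi / 2 : ℝ) : Orientation)

/-- A cost function, giving the quality of an orientation for a point set of any size. -/
abbrev CostFunction : Type := (n : ℕ) → Orientation → (Fin n → Plane) → ℝ

/-- Oriented bounding box: the area of the smallest box with orientation `α`. -/
def obbCost : CostFunction := fun _ α p => extent α p * extent (perp α) p

/-- Covering strip: the width of the thinnest strip with orientation `α`. -/
def stripCost : CostFunction := fun _ α p => extent (perp α) p

/-- The diameter of a point set. -/
def diameter {n : ℕ} (p : Fin n → Plane) : ℝ := Metric.diam (Set.range p)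

/-- `θ` is an angle of the line through a diametrical pair of the point set. (If `θ` is such an
angle, then so is `θ + π`, since the pair can be swapped.) -/
def IsDiametricAngle {n : ℕ} (p : Fin n → Plane) (θ : ℝ) : Prop :=
  ∃ i j : Fin n, dist (p i) (p j) = diameter p ∧ p j - p i = diameter p • dir θ

/-- The aspect ratio `W / D` of the bounding box with orientation `θ`, where `D` is the diameter
and `W` the width of the thinnest strip with orientation `θ`. -/
def aspectRatio {n : ℕ} (p : Fin n → Plane) (θ : ℝ) : ℝ :=
  extentAngle p (θ + Real.pi / 2) / diameter p

/-- A moving point set; only times in an interval `[0, T]` will matter. -/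
abbrev Motion (n : ℕ) : Type := ℝ → Fin n → Plane

/-- On `[0, T]` every point moves with at most unit speed and the diameter is at least `1`. -/
structure Admissible {n : ℕ} (P : Motion n) (T : ℝ) : Prop where
  nonneg : 0 ≤ T
  unit_speed : ∀ i, LipschitzOnWith 1 (fun t => P t i) (Set.Icc 0 T)
  one_le_diameter : ∀ t ∈ Set.Icc 0 T, 1 ≤ diameter (P t)

/-- A state-aware, not clairvoyant, algorithm: its output at time `t` is an orientation that is
determined by the motion up to time `t`. -/
structure Algorithm where
  /-- the output for a given motion at a given time -/
  out : (n : ℕ) → Motion n → ℝ → Orientation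
  causal : ∀ (n : ℕ) (P Q : Motion n) (t : ℝ),
    (∀ s ∈ Set.Icc 0 t, P s = Q s) → out n P t = out n Q t

/-- The output rotates by at most `K` radians per time unit. -/
def Algorithm.IsLipschitz (A : Algorithm) (K : ℝ≥0) : Prop :=
  ∀ (n : ℕ) (P : Motion n) (T : ℝ), Admissible P T →
    LipschitzOnWith K (A.out n P) (Set.Icc 0 T)

/-- The worst ratio, over all motions and times, between the cost of the output and the minimum
cost. In `ℝ≥0∞` a positive cost divided by the minimum cost `0` is `∞`. -/
def Algorithm.ratio (A : Algorithm) (f : CostFunction) : ℝ≥0∞ :=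
  ⨆ (n : ℕ) (P : Motion n) (T : ℝ) (_ : Admissible P T) (t : ℝ) (_ : t ∈ Set.Icc 0 T),
    ENNReal.ofReal (f n (A.out n P t) (P t)) / ⨅ γ : Orientation, ENNReal.ofReal (f n γ (P t))

/-- The `K`-Lipschitz stability ratio of the shape descriptor with cost function `f`. -/
def lipschitzStabilityRatio (f : CostFunction) (K : ℝ≥0) : ℝ≥0∞ :=
  ⨅ (A : Algorithm) (_ : A.IsLipschitz K), A.ratio f

/-- The tolerated angle between the output and the orientation of a diametrical pair, depending on
the aspect ratio `z` of the diametric box. All orientations are tolerated once it is `≥ π / 2`. -/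
def tolerance (z : ℝ) : ℝ := 8 * Real.arcsin z

/-- At time `t`, the moving orientation `β` is aligned with a diametrical pair of `p` or rotates
towards its orientation at speed exactly `K`. Here `b` represents `β` by real angles near time `t`,
and `θ` is the representative of the diametrical orientation towards which `β` rotates. The rotation
is along the shorter arc unless the diametric box is so fat that all orientations are tolerated;
in that case the direction is the choice of the algorithm. -/
def ChasesDiameterAt (K : ℝ≥0) {n : ℕ} (p : Fin n → Plane) (β : ℝ → Orientation) (t : ℝ) : Prop :=
  ∃ (θ : ℝ) (b : ℝ → ℝ), IsDiametricAngle p θ ∧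
    (∀ᶠ s in nhds t, ((b s : ℝ) : Orientation) = β s) ∧
    |θ - b t| < Real.pi ∧
    (tolerance (aspectRatio p θ) < Real.pi / 2 → |θ - b t| ≤ Real.pi / 2) ∧
    (θ ≠ b t → HasDerivAt b (K * Real.sign (θ - b t)) t)

/-- The algorithm starts at the orientation of a diametrical pair and chases the orientation of the
diametrical pair at speed `K`. -/
def Algorithm.IsChasingDiameter (A : Algorithm) (K : ℝ≥0) : Prop :=
  ∀ (n : ℕ) (P : Motion n) (T : ℝ), Admissible P T →
    (∃ θ : ℝ, IsDiametricAngle (P 0) θ ∧ A.out n P 0 = (θ : Orientation)) ∧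
    ∀ᵐ t ∂(MeasureTheory.volume.restrict (Set.Icc 0 T)),
      ChasesDiameterAt K (P t) (A.out n P) t

/-- At all times the output is within the tolerated angle of every diametrical pair. -/
def Algorithm.StaysWithinTolerance (A : Algorithm) : Prop :=
  ∀ (n : ℕ) (P : Motion n) (T : ℝ), Admissible P T → ∀ t ∈ Set.Icc 0 T,
    ∀ θ : ℝ, IsDiametricAngle (P t) θ →
      dist (A.out n P t) (θ : Orientation) ≤ tolerance (aspectRatio (P t) θ)

end OrientationStability

end

/-!
The output is represented by a real angle that pursues, at speed `43`, a real representative `Θ (t)`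
of the orientation of a diametrical pair, selected measurably from the position of the points. The
pair may jump back and forth on a set of times of positive measure, so the pursuit is an ordinary
differential equation with a right-hand side that is discontinuous in time and space; it is
nevertheless well posed, because moving towards a target never increases the distance of two
pursuers (`exists_isPursuit`, `IsPursuit.eq_of_eqOn`). Uniqueness makes the output causal
(`IsSteady.chase_congr`).

On the projective line "towards the target" is ambiguous at the antipode, and the choice of
representative has to be consistent over time. The choice is made anew every `1 / 20` time units. If
the points are then covered by a fairly thin strip (`IsFlat`), all diametrical orientations of the
coming step lie in a cone of less than a right angle, and the representatives nearest to the output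
are taken. Otherwise no orientation is excluded during the step, and the output rotates in the
positive direction throughout.

The key estimate is `IsSteady.exists_abs_chase_sub_le`. If the box of a diametrical pair with
orientation `α` has an aspect ratio `z < sin (π / 16)` at time `t`, then the points lie, at time
`t - s` with `s ≤ 1 / 10`, in a strip along `α` that is little wider, so all diametrical
orientations at that time are within `arcsin z + 3 s` of `α`. This window contains a full step, in
which the output can turn by `43 / 20`, enough to enter this cone from any orientation; and, once
inside, it stays there because the cone shrinks at speed `3 < 43`. So the output is even within
`arcsin z` of `α` at time `t`. For `z ≥ sin (π / 16)` the tolerance `8 arcsin z` is at least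
`π / 2` and excludes nothing.

For the ratios, let `D` be the diameter and `W = z D`. Every strip that covers the points has width
at least `W / 2`, since the altitude on the longest side of a triangle is its shortest
(`abs_inner_le_of_diametric`), and every bounding box has in addition a side of length at least
`D / √2`. The output achieves width `2 W` if `z < sin (π / 16)`, and always at most `D`.
-/

noncomputable section

namespace OrientationStability

open MeasureTheory Set Filter Topology

/-! ### Pursuit of a measurable target on the line -/

/-- `b` is `K`-Lipschitz and, after time `a`, moves towards the target `Θ` at speed `K` whenever it
is not there. Nothing but the speed bound is asked while `b` is at the target. -/
structure IsPursuit (K : ℝ≥0) (Θ : ℝ → ℝ) (a : ℝ) (b : ℝ → ℝ) : Prop where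
  lipschitz : LipschitzWith K b
  ae_hasDerivAt : ∀ᵐ t, a < t → b t ≠ Θ t → HasDerivAt b (K * Real.sign (Θ t - b t)) t

/-- A Lipschitz function that starts nonpositive and does not increase while it is positive stays
nonpositive. -/
theorem nonpos_of_ae_deriv_nonpos {L : ℝ≥0} {u : ℝ → ℝ} (hu : LipschitzWith L u) {a t : ℝ}
    (hat : a ≤ t) (ha : u a ≤ 0)
    (h : ∀ᵐ s, s ∈ Ioo a t → 0 < u s → deriv u s ≤ 0) : u t ≤ 0 := by
  by_contra! ht
  have hcl : IsCompact (Icc a t ∩ {s | u s ≤ 0}) :=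
    isCompact_Icc.inter_right (isClosed_le hu.continuous continuous_const)
  -- the last time at which `u` is nonpositive
  obtain ⟨s₀, ⟨hs₀, hus₀⟩, hmax⟩ := hcl.exists_isGreatest ⟨a, ⟨le_rfl, hat⟩, ha⟩
  have hpos : ∀ s ∈ Ioo s₀ t, 0 < u s := by
    intro s hs
    by_contra! hle
    exact absurd (hmax ⟨⟨hs₀.1.trans hs.1.le, hs.2.le⟩, hle⟩) (not_le.2 hs.1)
  have hac : AbsolutelyContinuousOnInterval u s₀ t :=
    hu.lipschitzOnWith.absolutelyContinuousOnInterval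
  have hint := hac.integral_deriv_eq_sub
  have hle : ∫ x in s₀..t, deriv u x ≤ ∫ _ in s₀..t, (0 : ℝ) := by
    refine intervalIntegral.integral_mono_ae_restrict hs₀.2 hac.intervalIntegrable_deriv
      intervalIntegrable_const ?_
    rw [← restrict_Ioo_eq_restrict_Icc]
    refine (ae_restrict_iff' measurableSet_Ioo).2 ?_
    filter_upwards [h] with s hs hs'
    exact hs ⟨hs₀.1.trans_lt hs'.1, hs'.2⟩ (hpos s hs')
  simp only [intervalIntegral.integral_zero] at hle
  simp only [mem_ofPred_eq] at hus₀
  linarith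

theorem IsPursuit.neg {K : ℝ≥0} {Θ b : ℝ → ℝ} {a : ℝ} (hb : IsPursuit K Θ a b) :
    IsPursuit K (fun t => -Θ t) a (fun t => -b t) := by
  refine ⟨hb.lipschitz.neg, ?_⟩
  filter_upwards [hb.ae_hasDerivAt] with t ht hat hne
  have := (ht hat (by simpa using hne)).neg
  rwa [← mul_neg, ← Real.sign_neg, neg_sub, ← neg_sub_neg] at this

theorem IsPursuit.mono_start {K : ℝ≥0} {Θ b : ℝ → ℝ} {a a' : ℝ} (hb : IsPursuit K Θ a b)
    (h : a ≤ a') : IsPursuit K Θ a' b :=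
  ⟨hb.lipschitz, by filter_upwards [hb.ae_hasDerivAt] with t ht hat using ht (h.trans_lt hat)⟩

theorem abs_deriv_le {K : ℝ≥0} {b : ℝ → ℝ} (hb : LipschitzWith K b) (t : ℝ) :
    |deriv b t| ≤ K := by
  simpa using norm_deriv_le_of_lipschitz (x₀ := t) hb

/-- Pursuit is monotone in the target and in the starting point. -/
theorem IsPursuit.le_of_le {K : ℝ≥0} {Θ Θ' b b' : ℝ → ℝ} {a t : ℝ} (hb : IsPursuit K Θ a b)
    (hb' : IsPursuit K Θ' a b') (hat : a ≤ t) (hΘ : ∀ s ∈ Ico a t, Θ s ≤ Θ' s)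
    (h0 : b a ≤ b' a) : b t ≤ b' t := by
  have := nonpos_of_ae_deriv_nonpos (hb.lipschitz.sub hb'.lipschitz) hat (by simpa using h0) ?_
  · simpa using this
  filter_upwards [hb.ae_hasDerivAt, hb'.ae_hasDerivAt, hb.lipschitz.ae_differentiableAt_real,
    hb'.lipschitz.ae_differentiableAt_real] with s h h' hd hd' hs hpos
  have hpos : b' s < b s := by simpa using hpos
  have hΘs := hΘ s ⟨hs.1.le, hs.2⟩
  have e : deriv (b - b') s = deriv b s - deriv b' s := (hd.hasDerivAt.sub hd'.hasDerivAt).deriv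
  have e1 := abs_le.1 (abs_deriv_le hb.lipschitz s)
  have e2 := abs_le.1 (abs_deriv_le hb'.lipschitz s)
  change deriv (b - b') s ≤ 0
  rw [e]
  by_cases hlt : Θ s < b s
  · have := (h hs.1 hlt.ne').deriv
    rw [Real.sign_of_neg (by linarith)] at this
    linarith
  · have := (h' hs.1 (by linarith)).deriv
    rw [Real.sign_of_pos (by linarith)] at this
    linarith

/-- Pursuits of the same target from the same starting point agree. -/
theorem IsPursuit.eq_of_eqOn {K : ℝ≥0} {Θ Θ' b b' : ℝ → ℝ} {a t : ℝ} (hb : IsPursuit K Θ a b)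
    (hb' : IsPursuit K Θ' a b') (hat : a ≤ t) (hΘ : ∀ s ∈ Ico a t, Θ s = Θ' s)
    (h0 : b a = b' a) : b t = b' t :=
  le_antisymm (hb.le_of_le hb' hat (fun s hs => (hΘ s hs).le) h0.le)
    (hb'.le_of_le hb hat (fun s hs => (hΘ s hs).ge) h0.ge)

/-- If the target stays below a barrier that decreases at the speed of the pursuer until time `t`,
and the pursuer starts below the barrier, then it ends below the barrier: while above, it moves down
as fast as the barrier. -/
theorem IsPursuit.le_of_target_le {K : ℝ≥0} {Θ b : ℝ → ℝ} {a t m : ℝ} (hb : IsPursuit K Θ a b)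
    (hat : a ≤ t) (hΘ : ∀ s ∈ Ico a t, Θ s ≤ m + K * (t - s)) (h0 : b a ≤ m + K * (t - a)) :
    b t ≤ m := by
  have hlin : LipschitzWith K (fun s : ℝ => m + K * (t - s)) :=
    LipschitzWith.of_dist_le_mul fun x y => by
      rw [Real.dist_eq, Real.dist_eq,
        show m + K * (t - x) - (m + K * (t - y)) = -(K * (x - y)) by ring, abs_neg, abs_mul,
        NNReal.abs_eq]
  have := nonpos_of_ae_deriv_nonpos (hb.lipschitz.sub hlin) hat (by simpa using h0) ?_
  · simpa using this
  filter_upwards [hb.ae_hasDerivAt] with s h hs hpos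
  have hpos : m + K * (t - s) < b s := by simpa using hpos
  have hlt : Θ s < b s := (hΘ s ⟨hs.1.le, hs.2⟩).trans_lt hpos
  have hd := h hs.1 hlt.ne'
  rw [Real.sign_of_neg (by linarith)] at hd
  have hd' : HasDerivAt (fun s : ℝ => m + K * (t - s)) (K * (-1 : ℝ)) s :=
    (((hasDerivAt_id s).const_sub t).const_mul (K : ℝ)).const_add m
  have hd2 : HasDerivAt (b - fun s : ℝ => m + K * (t - s)) 0 s := by
    simpa using hd.sub hd'
  exact hd2.deriv.le

theorem IsPursuit.le_of_le_target {K : ℝ≥0} {Θ b : ℝ → ℝ} {a t m : ℝ} (hb : IsPursuit K Θ a b)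
    (hat : a ≤ t) (hΘ : ∀ s ∈ Ico a t, m - K * (t - s) ≤ Θ s) (h0 : m - K * (t - a) ≤ b a) :
    m ≤ b t := by
  have := hb.neg.le_of_target_le hat (m := -m) (fun s hs => by have := hΘ s hs; linarith)
    (by linarith)
  linarith

/-- A pursuer of a target that is confined to a neighbourhood of `c`, shrinking no faster than the
pursuer moves, ends in that neighbourhood, if it has the time to reach it. -/
theorem IsPursuit.abs_sub_le {K : ℝ≥0} {Θ b : ℝ → ℝ} {a t c ρ : ℝ} (hb : IsPursuit K Θ a b)
    (hat : a ≤ t) (hΘ : ∀ s ∈ Ico a t, |Θ s - c| ≤ ρ + K * (t - s))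
    (h0 : |b a - c| ≤ ρ + K * (t - a)) : |b t - c| ≤ ρ := by
  rw [abs_le]
  constructor
  · have := hb.le_of_le_target hat (m := c - ρ)
      (fun s hs => by have := (abs_le.1 (hΘ s hs)).1; linarith)
      (by have := (abs_le.1 h0).1; linarith)
    linarith
  · have := hb.le_of_target_le hat (m := c + ρ)
      (fun s hs => by have := (abs_le.1 (hΘ s hs)).2; linarith)
      (by have := (abs_le.1 h0).2; linarith)
    linarith

theorem measurable_sign : Measurable Real.sign := by
  unfold Real.sign
  exact Measurable.ite measurableSet_Iio measurable_const
    (Measurable.ite measurableSet_Ioi measurable_const measurable_const)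

theorem abs_sign_le_one (x : ℝ) : |Real.sign x| ≤ 1 := by
  rcases Real.sign_apply_eq x with h | h | h <;> simp [h]

theorem locallyIntegrable_of_abs_le {g : ℝ → ℝ} {C : ℝ} (hg : Measurable g)
    (hC : ∀ s, |g s| ≤ C) : LocallyIntegrable g volume := by
  refine (memLp_top_of_bound hg.aestronglyMeasurable C
    (Eventually.of_forall hC)).locallyIntegrable (by simp)

theorem intervalIntegrable_of_abs_le {g : ℝ → ℝ} {C : ℝ} (hg : Measurable g)
    (hC : ∀ s, |g s| ≤ C) (x y : ℝ) : IntervalIntegrable g volume x y :=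
  intervalIntegrable_iff.2 (((locallyIntegrable_of_abs_le hg hC).integrableOn_isCompact
    isCompact_uIcc).mono_set uIoc_subset_uIcc)

theorem lipschitzWith_add_integral {g : ℝ → ℝ} {K : ℝ≥0} (hg : Measurable g)
    (hK : ∀ s, |g s| ≤ K) (c a : ℝ) : LipschitzWith K (fun t => c + ∫ s in a..t, g s) := by
  refine LipschitzWith.of_dist_le_mul fun x y => ?_
  rw [Real.dist_eq, add_sub_add_left_eq_sub, intervalIntegral.integral_interval_sub_left
    (intervalIntegrable_of_abs_le hg hK _ _) (intervalIntegrable_of_abs_le hg hK _ _)]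
  exact intervalIntegral.norm_integral_le_of_norm_le_const (f := g) fun s _ => hK s

/-- An Euler scheme: a curve that moves, at speed `K`, towards the target as seen from a position
`e` that is within `ε` of the actual one. -/
theorem exists_approx_pursuit (K : ℝ≥0) {Θ : ℝ → ℝ} (hΘ : Measurable Θ) (a c : ℝ) {ε : ℝ}
    (hε : 0 < ε) : ∃ e : ℝ → ℝ, Measurable e ∧
      ∀ t, a ≤ t → |c + (∫ s in a..t, K * Real.sign (Θ s - e s)) - e t| ≤ ε := by
  set δ : ℝ := ε / (K + 1) with hδ
  have hδ0 : 0 < δ := by positivity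
  have hKδ : K * δ ≤ ε := by
    rw [hδ, mul_div_assoc', div_le_iff₀ (by positivity)]
    nlinarith
  let E : ℕ → ℝ := fun j => Nat.rec c
    (fun j x => x + ∫ s in (a + j * δ)..(a + (j + 1 : ℕ) * δ), K * Real.sign (Θ s - x)) j
  have hE (j : ℕ) : E (j + 1) =
      E j + ∫ s in (a + j * δ)..(a + (j + 1 : ℕ) * δ), K * Real.sign (Θ s - E j) := rfl
  -- on the grid cell `(a + j δ, a + (j + 1) δ]` the ceiling is `j + 1`
  let e : ℝ → ℝ := fun s => E (⌈(s - a) / δ⌉₊ - 1)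
  have he : Measurable e :=
    (measurable_from_top (f := fun n : ℕ => E (n - 1))).comp
      (Nat.measurable_ceil.comp ((measurable_id.sub_const a).div_const δ))
  have hcell (j : ℕ) (s : ℝ) (h1 : a + j * δ < s) (h2 : s ≤ a + (j + 1 : ℕ) * δ) :
      e s = E j := by
    have : ⌈(s - a) / δ⌉₊ = j + 1 := by
      rw [Nat.ceil_eq_iff (by simp)]
      constructor
      · rw [lt_div_iff₀ hδ0]; simp; linarith
      · rw [div_le_iff₀ hδ0]; linarith
    simp only [e, this, Nat.add_sub_cancel]
  set g : ℝ → ℝ := fun s => K * Real.sign (Θ s - e s) with hg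
  have hgm : Measurable g := (measurable_sign.comp (hΘ.sub he)).const_mul _
  have hgK (s : ℝ) : |g s| ≤ K := by
    rw [hg, abs_mul, NNReal.abs_eq]
    exact mul_le_of_le_one_right K.2 (abs_sign_le_one _)
  have hlip := lipschitzWith_add_integral hgm hgK c a
  have hgrid (j : ℕ) : c + ∫ s in a..(a + j * δ), g s = E j := by
    induction j with
    | zero => simp [E]
    | succ j ih =>
      rw [hE, ← ih, add_assoc, ← intervalIntegral.integral_add_adjacent_intervals
        (intervalIntegrable_of_abs_le hgm hgK a (a + j * δ))
        (intervalIntegrable_of_abs_le hgm hgK _ _), ih]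
      congr 2
      refine intervalIntegral.integral_congr_ae (Eventually.of_forall fun s hs => ?_)
      rw [uIoc_of_le (by push_cast; linarith)] at hs
      simp only [hg, hcell j s hs.1 hs.2]
  refine ⟨e, he, fun t hat => ?_⟩
  change |(c + ∫ s in a..t, g s) - e t| ≤ ε
  rcases hat.eq_or_lt with rfl | hat
  · have : e a = c := by simp [e, E]
    simp [this, hε.le]
  · obtain ⟨j, hj⟩ : ∃ j, ⌈(t - a) / δ⌉₊ = j + 1 :=
      Nat.exists_eq_succ_of_ne_zero (Nat.ceil_pos.2 (div_pos (by linarith) hδ0)).ne'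
    rw [Nat.ceil_eq_iff (by simp), lt_div_iff₀ hδ0, div_le_iff₀ hδ0] at hj
    simp only [Nat.add_sub_cancel] at hj
    rw [hcell j t (by linarith) (by linarith), ← hgrid j]
    have := hlip.dist_le_mul t (a + j * δ)
    rw [Real.dist_eq, Real.dist_eq] at this
    refine this.trans (le_trans ?_ hKδ)
    gcongr
    have h1 := hj.1
    have h2 := hj.2
    push_cast at h2
    rw [abs_le]
    constructor <;> linarith

/-- If the increments of the `K`-Lipschitz function `b` are limits of integrals of velocities `g n`
that on `A` are eventually equal to `K`, then `b` has derivative `K` almost everywhere on `A`: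
there the increments lie between those of speed `K` and those of the integral of `K` on `A` and
`-K` off `A`. -/
theorem ae_hasDerivAt_of_eventually_eq {K : ℝ≥0} {b : ℝ → ℝ} {A : Set ℝ} {g : ℕ → ℝ → ℝ} {a : ℝ}
    (hb : LipschitzWith K b) (hA : MeasurableSet A) (hg : ∀ n, Measurable (g n))
    (hK : ∀ n s, |g n s| ≤ K)
    (hlim : ∀ x y, a ≤ x → x ≤ y →
      Tendsto (fun n => ∫ s in x..y, g n s) atTop (𝓝 (b y - b x)))
    (hgA : ∀ s ∈ A, ∀ᶠ n in atTop, g n s = K) :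
    ∀ᵐ t, t ∈ A → a < t → HasDerivAt b K t := by
  classical
  let f : ℕ → ℝ → ℝ := fun n => A.piecewise (g n) (fun _ => -(K : ℝ))
  let h : ℝ → ℝ := A.piecewise (fun _ => (K : ℝ)) (fun _ => -(K : ℝ))
  have hfm (n : ℕ) : Measurable (f n) := (hg n).piecewise hA measurable_const
  have hhm : Measurable h := measurable_const.piecewise hA measurable_const
  have hfK (n : ℕ) (s : ℝ) : |f n s| ≤ K := by
    by_cases hs : s ∈ A <;> simp [f, hs, hK]
  have hhK (s : ℝ) : |h s| ≤ K := by
    by_cases hs : s ∈ A <;> simp [h, hs]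
  have hincr (x y : ℝ) (hax : a ≤ x) (hxy : x ≤ y) : ∫ s in x..y, h s ≤ b y - b x := by
    have hf : Tendsto (fun n => ∫ s in x..y, f n s) atTop (𝓝 (∫ s in x..y, h s)) := by
      refine intervalIntegral.tendsto_integral_filter_of_dominated_convergence (fun _ => (K : ℝ))
        (Eventually.of_forall fun n => (hfm n).aestronglyMeasurable)
        (Eventually.of_forall fun n => Eventually.of_forall fun s _ => hfK n s)
        intervalIntegrable_const (Eventually.of_forall fun s _ => ?_)
      by_cases hs : s ∈ A
      · refine tendsto_const_nhds.congr' ?_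
        filter_upwards [hgA s hs] with n hn
        simp [f, h, hs, hn]
      · simp [f, h, hs]
    refine le_of_tendsto_of_tendsto' hf (hlim x y hax hxy) fun n => ?_
    refine intervalIntegral.integral_mono_on hxy (intervalIntegrable_of_abs_le (hfm n) (hfK n) _ _)
      (intervalIntegrable_of_abs_le (hg n) (hK n) _ _) fun s _ => ?_
    by_cases hs : s ∈ A
    · simp [f, hs]
    · simpa [f, hs] using (abs_le.1 (hK n s)).1
  filter_upwards [_root_.LocallyIntegrable.ae_hasDerivAt_integral
    (locallyIntegrable_of_abs_le hhm hhK)] with t ht htA hat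
  have hd := ht a
  rw [show h t = K by simp [h, htA], hasDerivAt_iff_isLittleO] at hd
  rw [hasDerivAt_iff_isLittleO]
  refine Asymptotics.IsBigO.trans_isLittleO (Asymptotics.IsBigO.of_bound 1 ?_) hd
  filter_upwards [Ioi_mem_nhds hat] with y hy
  have hy : a < y := hy
  rw [intervalIntegral.integral_interval_sub_left
    (intervalIntegrable_of_abs_le hhm hhK _ _) (intervalIntegrable_of_abs_le hhm hhK _ _)]
  simp only [smul_eq_mul, Real.norm_eq_abs, one_mul]
  have hl := hb.dist_le_mul y t
  rw [Real.dist_eq, Real.dist_eq] at hl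
  rcases le_total t y with hty | hty
  · have h1 := hincr t y hat.le hty
    rw [abs_of_nonneg (sub_nonneg.2 hty)] at hl
    have h2 := (abs_le.1 hl).2
    rw [abs_of_nonpos (a := b y - b t - _) (by linarith)]
    refine le_trans ?_ (neg_le_abs _)
    linarith
  · have h1 := hincr y t hy.le hty
    rw [abs_of_nonpos (sub_nonpos.2 hty)] at hl
    have h2 := (abs_le.1 hl).1
    rw [abs_of_nonneg (a := b y - b t - _) (by linarith)]
    refine le_trans ?_ (le_abs_self _)
    rw [intervalIntegral.integral_symm]
    linarith

/-- Every measurable target can be pursued from every starting point. -/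
theorem exists_isPursuit (K : ℝ≥0) {Θ : ℝ → ℝ} (hΘ : Measurable Θ) (a c : ℝ) :
    ∃ b, IsPursuit K Θ a b ∧ b a = c := by
  let ε : ℕ → ℝ := fun n => 1 / ((n : ℝ) + 1)
  have hε (n : ℕ) : 0 < ε n := by positivity
  have hε0 : Tendsto ε atTop (𝓝 0) := tendsto_one_div_add_atTop_nhds_zero_nat
  choose e he hbe using fun n => exists_approx_pursuit K hΘ a c (hε n)
  let g : ℕ → ℝ → ℝ := fun n s => K * Real.sign (Θ s - e n s)
  let B : ℕ → ℝ → ℝ := fun n t => c + ∫ s in a..t, g n s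
  have hbe (n : ℕ) (t : ℝ) (ht : a ≤ t) : |B n t - e n t| ≤ ε n := hbe n t ht
  have hgm (n : ℕ) : Measurable (g n) := (measurable_sign.comp (hΘ.sub (he n))).const_mul _
  have hgK (n : ℕ) (s : ℝ) : |g n s| ≤ K := by
    rw [show g n s = K * Real.sign (Θ s - e n s) from rfl, abs_mul, NNReal.abs_eq]
    exact mul_le_of_le_one_right K.2 (abs_sign_le_one _)
  have hBL (n : ℕ) : LipschitzWith K (B n) := lipschitzWith_add_integral (hgm n) (hgK n) c a
  have hBd (n : ℕ) : ∀ᵐ s, HasDerivAt (B n) (g n s) s := by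
    filter_upwards [_root_.LocallyIntegrable.ae_hasDerivAt_integral
      (locallyIntegrable_of_abs_le (hgm n) (hgK n))] with s hs
    exact (hs a).const_add c
  have hcomp (n m : ℕ) (t : ℝ) (ht : a ≤ t) : B n t - B m t ≤ ε n + ε m := by
    have := nonpos_of_ae_deriv_nonpos
      (((hBL n).sub (hBL m)).sub (LipschitzWith.const (ε n + ε m))) ht
      (by simp [B]; linarith [hε n, hε m]) ?_
    · simpa using this
    filter_upwards [hBd n, hBd m] with s h1 h2 hs hpos
    have hd : HasDerivAt (B n - B m - fun _ => ε n + ε m) (g n s - g m s) s := by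
      simpa using (h1.sub h2).sub (hasDerivAt_const s (ε n + ε m))
    change deriv (B n - B m - fun _ => ε n + ε m) s ≤ 0
    rw [hd.deriv]
    have hpos : 0 < B n s - B m s - (ε n + ε m) := hpos
    have h3 := abs_le.1 (hbe n s hs.1.le)
    have h4 := abs_le.1 (hbe m s hs.1.le)
    -- the positions seen are in the same order as the actual ones, so the velocities are ordered
    have hlt : e m s < e n s := by linarith
    have : Real.sign (Θ s - e n s) ≤ Real.sign (Θ s - e m s) := by
      rcases lt_trichotomy (Θ s) (e n s) with h | h | h
      · rw [Real.sign_of_neg (by linarith)]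
        exact (abs_le.1 (abs_sign_le_one _)).1
      · rw [Real.sign_of_pos (by linarith : 0 < Θ s - e m s)]
        exact (abs_le.1 (abs_sign_le_one _)).2
      · rw [Real.sign_of_pos (by linarith : 0 < Θ s - e m s)]
        exact (abs_le.1 (abs_sign_le_one _)).2
    have := mul_le_mul_of_nonneg_left this K.2
    exact sub_nonpos.2 this
  have hcauchy (t : ℝ) : CauchySeq fun n => B n (max t a) := by
    refine Metric.cauchySeq_iff'.2 fun η hη => ?_
    obtain ⟨N, hN⟩ := eventually_atTop.1 (hε0.eventually (gt_mem_nhds (half_pos hη)))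
    refine ⟨N, fun n hn => ?_⟩
    have h1 := hcomp n N _ (le_max_right t a)
    have h2 := hcomp N n _ (le_max_right t a)
    have h3 := hN n hn
    have h4 := hN N le_rfl
    rw [Real.dist_eq, abs_lt]
    constructor <;> linarith
  choose b hb using fun t => cauchySeq_tendsto_of_complete (hcauchy t)
  have hb' (t : ℝ) (ht : a ≤ t) : Tendsto (fun n => B n t) atTop (𝓝 (b t)) := by
    simpa [max_eq_left ht] using hb t
  have he' (t : ℝ) (ht : a ≤ t) : Tendsto (fun n => e n t) atTop (𝓝 (b t)) := by
    have : Tendsto (fun n => B n t - e n t) atTop (𝓝 0) :=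
      squeeze_zero_norm (fun n => hbe n t ht) hε0
    simpa using (hb' t ht).sub this
  have hbL : LipschitzWith K b := by
    refine LipschitzWith.of_dist_le_mul fun x y => ?_
    refine le_of_tendsto' ((hb x).dist (hb y)) fun n => ((hBL n).dist_le_mul _ _).trans ?_
    gcongr
    rw [Real.dist_eq, Real.dist_eq]
    exact abs_max_sub_max_le_abs x y a
  have hlim (x y : ℝ) (hx : a ≤ x) (hxy : x ≤ y) :
      Tendsto (fun n => ∫ s in x..y, g n s) atTop (𝓝 (b y - b x)) := by
    refine ((hb' y (hx.trans hxy)).sub (hb' x hx)).congr fun n => ?_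
    simp only [B]
    rw [add_sub_add_left_eq_sub, intervalIntegral.integral_interval_sub_left
      (intervalIntegrable_of_abs_le (hgm n) (hgK n) _ _)
      (intervalIntegrable_of_abs_le (hgm n) (hgK n) _ _)]
  have hup := ae_hasDerivAt_of_eventually_eq (A := {s | b s < Θ s} ∩ Ici a) hbL
    ((measurableSet_lt hbL.continuous.measurable hΘ).inter measurableSet_Ici) hgm hgK hlim
    (fun s hs => by
      filter_upwards [(he' s hs.2).eventually (gt_mem_nhds hs.1)] with n hn
      simp [g, Real.sign_of_pos (sub_pos.2 hn)])
  have hdown := ae_hasDerivAt_of_eventually_eq (b := -b) (A := {s | Θ s < b s} ∩ Ici a)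
    (g := fun n s => -g n s) (a := a) hbL.neg
    ((measurableSet_lt hΘ hbL.continuous.measurable).inter measurableSet_Ici)
    (fun n => (hgm n).neg) (fun n s => by rw [abs_neg]; exact hgK n s)
    (fun x y hx hxy => by
      have := (hlim x y hx hxy).neg
      simpa [neg_add_eq_sub, intervalIntegral.integral_neg] using this)
    (fun s hs => by
      filter_upwards [(he' s hs.2).eventually (lt_mem_nhds hs.1)] with n hn
      simp [g, Real.sign_of_neg (sub_neg.2 hn)])
  refine ⟨b, ⟨hbL, ?_⟩, ?_⟩
  · filter_upwards [hup, hdown] with t h1 h2 hat hne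
    rcases hne.lt_or_gt with h | h
    · rw [Real.sign_of_pos (sub_pos.2 h), mul_one]
      exact h1 ⟨h, hat.le⟩ hat
    · rw [Real.sign_of_neg (sub_neg.2 h)]
      simpa using (h2 ⟨h, hat.le⟩ hat).neg
  · refine tendsto_nhds_unique (hb' a le_rfl) ?_
    simp [B]

/-! ### Extents, diameter and diametric angles of a point set -/

theorem inner_dir (v : Plane) (φ : ℝ) :
    inner ℝ v (dir φ) = v 0 * Real.cos φ + v 1 * Real.sin φ := by
  simp [PiLp.inner_apply, dir, Fin.sum_univ_two, mul_comm]

theorem inner_dir_eq (v : Plane) (θ φ : ℝ) :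
    inner ℝ v (dir φ) = Real.cos (φ - θ) * inner ℝ v (dir θ) +
      Real.sin (φ - θ) * inner ℝ v (dir (θ + Real.pi / 2)) := by
  simp only [inner_dir, Real.cos_add_pi_div_two, Real.sin_add_pi_div_two, Real.cos_sub,
    Real.sin_sub]
  have := Real.sin_sq_add_cos_sq θ
  linear_combination (-v 0 * Real.cos φ - v 1 * Real.sin φ) * this

theorem inner_dir_sq_add_sq (v : Plane) (θ : ℝ) :
    inner ℝ v (dir θ) ^ 2 + inner ℝ v (dir (θ + Real.pi / 2)) ^ 2 = ‖v‖ ^ 2 := by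
  rw [EuclideanSpace.norm_sq_eq]
  simp only [inner_dir, Real.cos_add_pi_div_two, Real.sin_add_pi_div_two, Fin.sum_univ_two,
    Real.norm_eq_abs, sq_abs]
  have := Real.sin_sq_add_cos_sq θ
  linear_combination (v 0 ^ 2 + v 1 ^ 2) * this

theorem norm_dir (θ : ℝ) : ‖dir θ‖ = 1 := by
  rw [← sq_eq_sq₀ (norm_nonneg _) zero_le_one, EuclideanSpace.norm_sq_eq]
  simp [dir, Fin.sum_univ_two]

theorem inner_smul_dir_dir (r θ φ : ℝ) :
    inner ℝ (r • dir θ) (dir φ) = r * Real.cos (θ - φ) := by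
  rw [inner_dir, Real.cos_sub]
  simp [dir]
  ring

/-- The polar angle of a vector of the plane. -/
def angleOf (v : Plane) : ℝ := Complex.arg ⟨v 0, v 1⟩

theorem measurable_angleOf : Measurable angleOf := by
  unfold angleOf
  refine Complex.measurable_arg.comp ?_
  have : Continuous fun v : Plane => Complex.equivRealProdCLM.symm (v 0, v 1) := by fun_prop
  exact this.measurable

theorem norm_smul_dir_angleOf (v : Plane) : ‖v‖ • dir (angleOf v) = v := by
  have hn : ‖v‖ = ‖(⟨v 0, v 1⟩ : ℂ)‖ := by
    rw [EuclideanSpace.norm_eq, Complex.norm_eq_sqrt_sq_add_sq]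
    simp [Fin.sum_univ_two]
  ext i
  fin_cases i
  · simp [dir, angleOf, hn]
  · simp [dir, angleOf, hn]

variable {n : ℕ}

theorem extent_coe (p : Fin n → Plane) (φ : ℝ) :
    extent (φ : Orientation) p = extentAngle p φ := rfl

theorem perp_coe (φ : ℝ) : perp (φ : Orientation) = ((φ + Real.pi / 2 : ℝ) : Orientation) := rfl

theorem nonempty_of_diameter_pos {p : Fin n → Plane} (h : 0 < diameter p) : Nonempty (Fin n) := by
  by_contra hn
  rw [not_nonempty_iff] at hn
  simp [diameter, range_eq_empty] at h

theorem dist_le_diameter (p : Fin n → Plane) (i j : Fin n) : dist (p i) (p j) ≤ diameter p :=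
  Metric.dist_le_diam_of_mem (finite_range p).isBounded (mem_range_self i) (mem_range_self j)

theorem inner_le_extentAngle (p : Fin n → Plane) (i j : Fin n) (φ : ℝ) :
    inner ℝ (p i - p j) (dir φ) ≤ extentAngle p φ :=
  le_ciSup (f := fun ij : Fin n × Fin n => inner ℝ (p ij.1 - p ij.2) (dir φ))
    (finite_range _).bddAbove (i, j)

theorem abs_inner_le_extentAngle (p : Fin n → Plane) (i j : Fin n) (φ : ℝ) :
    |inner ℝ (p i - p j) (dir φ)| ≤ extentAngle p φ := by
  refine abs_le'.2 ⟨inner_le_extentAngle p i j φ, ?_⟩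
  rw [← inner_neg_left, neg_sub]
  exact inner_le_extentAngle p j i φ

theorem extentAngle_le [Nonempty (Fin n)] {p : Fin n → Plane} {φ C : ℝ}
    (h : ∀ i j, inner ℝ (p i - p j) (dir φ) ≤ C) : extentAngle p φ ≤ C :=
  ciSup_le fun ij => h ij.1 ij.2

theorem extentAngle_nonneg [Nonempty (Fin n)] (p : Fin n → Plane) (φ : ℝ) :
    0 ≤ extentAngle p φ := by
  obtain ⟨i⟩ := ‹Nonempty (Fin n)›
  exact (abs_nonneg _).trans (abs_inner_le_extentAngle p i i φ)

theorem extentAngle_le_diameter [Nonempty (Fin n)] (p : Fin n → Plane) (φ : ℝ) :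
    extentAngle p φ ≤ diameter p := by
  refine extentAngle_le fun i j => (real_inner_le_norm _ _).trans ?_
  rw [norm_dir, mul_one, ← dist_eq_norm]
  exact dist_le_diameter p i j

theorem extentAngle_le_cos_add_sin [Nonempty (Fin n)] (p : Fin n → Plane) (θ φ : ℝ) :
    extentAngle p φ ≤ |Real.cos (φ - θ)| * extentAngle p θ +
      |Real.sin (φ - θ)| * extentAngle p (θ + Real.pi / 2) := by
  refine extentAngle_le fun i j => ?_
  rw [inner_dir_eq _ θ φ]
  refine (le_abs_self _).trans ((abs_add_le _ _).trans ?_)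
  rw [abs_mul, abs_mul]
  gcongr <;> exact abs_inner_le_extentAngle p i j _

theorem extentAngle_le_add [Nonempty (Fin n)] {p q : Fin n → Plane} {s : ℝ}
    (h : ∀ i, dist (p i) (q i) ≤ s) (φ : ℝ) : extentAngle p φ ≤ extentAngle q φ + 2 * s := by
  refine extentAngle_le fun i j => ?_
  have hb (i : Fin n) : |inner ℝ (p i - q i) (dir φ)| ≤ s := by
    refine (abs_real_inner_le_norm _ _).trans ?_
    rw [norm_dir, mul_one, ← dist_eq_norm]
    exact h i
  have e : inner ℝ (p i - p j) (dir φ) = inner ℝ (q i - q j) (dir φ) +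
      inner ℝ (p i - q i) (dir φ) - inner ℝ (p j - q j) (dir φ) := by
    rw [← inner_add_left, ← inner_sub_left]
    congr 1
    abel
  have h1 := abs_le.1 (hb i)
  have h2 := abs_le.1 (hb j)
  have h3 := inner_le_extentAngle q i j φ
  linarith

theorem diameter_le_add {p q : Fin n → Plane} {s : ℝ} (hs : 0 ≤ s)
    (h : ∀ i, dist (p i) (q i) ≤ s) : diameter p ≤ diameter q + 2 * s := by
  refine Metric.diam_le_of_forall_dist_le (add_nonneg Metric.diam_nonneg (by linarith)) ?_
  rintro _ ⟨i, rfl⟩ _ ⟨j, rfl⟩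
  have h1 := dist_triangle4 (p i) (q i) (q j) (p j)
  have h2 := dist_le_diameter q i j
  have h3 := h j
  rw [dist_comm] at h3
  linarith [h i]

theorem isClosed_isDiametricPair (i j : Fin n) :
    IsClosed {p : Fin n → Plane | dist (p i) (p j) = diameter p} := by
  have : {p : Fin n → Plane | dist (p i) (p j) = diameter p} =
      ⋂ (k : Fin n) (l : Fin n), {p | dist (p k) (p l) ≤ dist (p i) (p j)} := by
    ext p
    simp only [mem_ofPred_eq, mem_iInter]
    refine ⟨fun h k l => h ▸ dist_le_diameter p k l, fun h => ?_⟩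
    refine le_antisymm (dist_le_diameter p i j) (Metric.diam_le_of_forall_dist_le dist_nonneg ?_)
    rintro _ ⟨k, rfl⟩ _ ⟨l, rfl⟩
    exact h k l
  rw [this]
  exact isClosed_iInter fun k => isClosed_iInter fun l =>
    isClosed_le (by fun_prop) (by fun_prop)

theorem exists_dist_eq_diameter [Nonempty (Fin n)] (p : Fin n → Plane) :
    ∃ i j, dist (p i) (p j) = diameter p := by
  obtain ⟨ij, hij⟩ := Finite.exists_max fun ij : Fin n × Fin n => dist (p ij.1) (p ij.2)
  refine ⟨ij.1, ij.2, le_antisymm (dist_le_diameter p _ _)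
    (Metric.diam_le_of_forall_dist_le dist_nonneg ?_)⟩
  rintro _ ⟨k, rfl⟩ _ ⟨l, rfl⟩
  exact hij (k, l)

theorem isDiametricAngle_angleOf {p : Fin n → Plane} {i j : Fin n}
    (h : dist (p i) (p j) = diameter p) : IsDiametricAngle p (angleOf (p j - p i)) := by
  refine ⟨i, j, h, ?_⟩
  conv_lhs => rw [← norm_smul_dir_angleOf (p j - p i)]
  rw [← h, dist_comm, dist_eq_norm]

/-- If finitely many measurable sets carry a measurable function each, then there is one measurable
function that agrees, at every point of their union, with the function of some set through it. -/
theorem exists_measurable_selection {ι X : Type*} [MeasurableSpace X] (s : Finset ι)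
    {E : ι → Set X} {f : ι → X → ℝ} (hE : ∀ i, MeasurableSet (E i))
    (hf : ∀ i, Measurable (f i)) :
    ∃ F : X → ℝ, Measurable F ∧ ∀ x, (∃ i ∈ s, x ∈ E i) → ∃ i, x ∈ E i ∧ F x = f i x := by
  classical
  induction s using Finset.induction_on with
  | empty => exact ⟨0, measurable_const, by simp⟩
  | insert a s _ ih =>
    obtain ⟨F, hF, hsel⟩ := ih
    refine ⟨(E a).piecewise (f a) F, (hf a).piecewise (hE a) hF, fun x ⟨i, hi, hx⟩ => ?_⟩
    by_cases hxa : x ∈ E a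
    · exact ⟨a, hxa, by simp [hxa]⟩
    · obtain rfl | hi := Finset.mem_insert.1 hi
      · exact absurd hx hxa
      · obtain ⟨k, hk, hk'⟩ := hsel x ⟨i, hi, hx⟩
        exact ⟨k, hk, by simp [hxa, hk']⟩

theorem exists_measurable_diametricAngle (n : ℕ) :
    ∃ F : (Fin n → Plane) → ℝ, Measurable F ∧
      ∀ p, Nonempty (Fin n) → IsDiametricAngle p (F p) := by
  obtain ⟨F, hF, h⟩ := exists_measurable_selection (Finset.univ : Finset (Fin n × Fin n))
    (E := fun ij => {p : Fin n → Plane | dist (p ij.1) (p ij.2) = diameter p})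
    (f := fun ij p => angleOf (p ij.2 - p ij.1))
    (fun ij => (isClosed_isDiametricPair ij.1 ij.2).measurableSet)
    (fun ij => measurable_angleOf.comp
      ((measurable_pi_apply ij.2).sub (measurable_pi_apply ij.1)))
  refine ⟨F, hF, fun p hp => ?_⟩
  obtain ⟨i, j, hij⟩ := exists_dist_eq_diameter p
  obtain ⟨k, hk, e⟩ := h p ⟨(i, j), Finset.mem_univ _, hij⟩
  rw [e]
  exact isDiametricAngle_angleOf hk

/-- An angle of a diametrical pair that depends measurably on the point set. -/
def diametricAngle (p : Fin n → Plane) : ℝ := (exists_measurable_diametricAngle n).choose p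

theorem measurable_diametricAngle :
    Measurable (diametricAngle : (Fin n → Plane) → ℝ) :=
  (exists_measurable_diametricAngle n).choose_spec.1

theorem isDiametricAngle_diametricAngle [h : Nonempty (Fin n)] (p : Fin n → Plane) :
    IsDiametricAngle p (diametricAngle p) :=
  (exists_measurable_diametricAngle n).choose_spec.2 p h

theorem IsDiametricAngle.diameter_mul_abs_cos_le {p : Fin n → Plane} {θ : ℝ}
    (h : IsDiametricAngle p θ) (φ : ℝ) : diameter p * |Real.cos (θ - φ)| ≤ extentAngle p φ := by
  obtain ⟨i, j, -, hij⟩ := h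
  have := abs_inner_le_extentAngle p j i φ
  rwa [hij, inner_smul_dir_dir, abs_mul,
    abs_of_nonneg (show 0 ≤ diameter p from Metric.diam_nonneg)] at this

/-- A strip of width `w` that covers the points makes an angle of sine at most `w / D` with every
diametrical pair. -/
theorem IsDiametricAngle.diameter_mul_abs_sin_le {p : Fin n → Plane} {θ : ℝ}
    (h : IsDiametricAngle p θ) (ψ : ℝ) :
    diameter p * |Real.sin (θ - ψ)| ≤ extentAngle p (ψ + Real.pi / 2) := by
  have := h.diameter_mul_abs_cos_le (ψ + Real.pi / 2)
  rwa [← sub_sub, Real.cos_sub_pi_div_two] at this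

theorem IsDiametricAngle.add_int_mul_pi {p : Fin n → Plane} {θ : ℝ}
    (h : IsDiametricAngle p θ) (m : ℤ) : IsDiametricAngle p (θ + m * Real.pi) := by
  obtain ⟨i, j, hd, hij⟩ := h
  rcases Int.even_or_odd m with hm | hm
  · refine ⟨i, j, hd, ?_⟩
    rw [hij]
    congr 1
    ext k
    fin_cases k <;> simp [dir, Real.cos_add_int_mul_pi, Real.sin_add_int_mul_pi, hm.neg_one_zpow]
  · refine ⟨j, i, by rwa [dist_comm], ?_⟩
    rw [← neg_sub, hij, ← smul_neg]
    congr 1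
    ext k
    fin_cases k <;> simp [dir, Real.cos_add_int_mul_pi, Real.sin_add_int_mul_pi, hm.neg_one_zpow]

theorem aspectRatio_mul_diameter {p : Fin n → Plane} (hD : 0 < diameter p) (θ : ℝ) :
    aspectRatio p θ * diameter p = extentAngle p (θ + Real.pi / 2) :=
  div_mul_cancel₀ _ hD.ne'

theorem aspectRatio_nonneg {p : Fin n → Plane} (hD : 0 < diameter p) (θ : ℝ) :
    0 ≤ aspectRatio p θ :=
  have := nonempty_of_diameter_pos hD
  div_nonneg (extentAngle_nonneg _ _) hD.le

/-! ### Lower bounds on the optimal costs -/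

/-- In a triangle the altitude on the longest side is the shortest altitude. Here the longest side
`D` and the two pieces `s` and `D - s` into which the altitude `y` cuts it are seen in a direction
whose angle with that side has cosine `c` and sine `σ`, in absolute value; `E` bounds the extent
of the triangle in that direction. -/
theorem altitude_le_extent {D s y c σ E : ℝ} (hD : 0 < D) (hy : 0 ≤ y)
    (hc : 0 ≤ c) (hσ : 0 ≤ σ) (hcσ : σ ^ 2 + c ^ 2 = 1) (hs : s ≤ D)
    (hlen : (D - s) ^ 2 + y ^ 2 ≤ D ^ 2) (h1 : D * c ≤ E) (h2 : s * c + y * σ ≤ E) : y ≤ E := by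
  by_contra! hlt
  have hσ1 : σ ≤ 1 := by nlinarith
  have hDc : D * c < y := h1.trans_lt hlt
  -- `y ^ 2 ≤ s * (2 D - s)`, and `2 D - s = D + (D - s)` is at most `D (1 + σ)`
  have hr : D - s ≤ D * σ := by
    refine abs_le_of_sq_le_sq' ?_ (by positivity) |>.2
    have : (D * c) ^ 2 ≤ y ^ 2 := pow_le_pow_left₀ (by positivity) hDc.le 2
    nlinarith
  have hs0 : 0 ≤ s := by nlinarith
  have hy2 : y ^ 2 ≤ s * (D * (1 + σ)) := by nlinarith
  have h3 : y * D * ((1 - σ) * (1 + σ)) ≤ s * c * (D * (1 + σ)) := by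
    have e : (1 - σ) * (1 + σ) = c ^ 2 := by linarith
    rw [e]
    calc y * D * c ^ 2 = y * (D * c) * c := by ring
      _ ≤ y * y * c := by gcongr
      _ = y ^ 2 * c := by ring
      _ ≤ s * (D * (1 + σ)) * c := by gcongr
      _ = _ := by ring
  have h4 : y * (1 - σ) ≤ s * c := by
    refine le_of_mul_le_mul_right ?_ (show 0 < D * (1 + σ) by positivity)
    linarith
  linarith

/-- The distance of every point from the line through a diametrical pair is at most the extent of
the point set along any direction. -/
theorem abs_inner_le_of_diametric {p : Fin n → Plane} {θ : ℝ} {i j : Fin n}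
    (hD : 0 < diameter p) (hij : p j - p i = diameter p • dir θ) (k : Fin n) (φ : ℝ) :
    |inner ℝ (p k - p i) (dir (θ + Real.pi / 2))| ≤ extentAngle p φ := by
  set D := diameter p
  set s := inner ℝ (p k - p i) (dir θ) with hs
  set y := inner ℝ (p k - p i) (dir (θ + Real.pi / 2)) with hy
  have hkj : p k - p j = (p k - p i) - D • dir θ := by rw [← hij]; abel
  have e1 : inner ℝ (p k - p j) (dir θ) = s - D := by
    rw [hkj, inner_sub_left, inner_smul_dir_dir]; simp [hs]
  have e2 : inner ℝ (p k - p j) (dir (θ + Real.pi / 2)) = y := by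
    rw [hkj, inner_sub_left, inner_smul_dir_dir]; simp [hy]
  have hki : s ^ 2 + y ^ 2 ≤ D ^ 2 := by
    rw [inner_dir_sq_add_sq, ← dist_eq_norm]
    exact pow_le_pow_left₀ dist_nonneg (dist_le_diameter p k i) 2
  have hkj2 : (D - s) ^ 2 + y ^ 2 ≤ D ^ 2 := by
    have := inner_dir_sq_add_sq (p k - p j) θ
    rw [e1, e2] at this
    rw [← neg_sub, neg_sq, this, ← dist_eq_norm]
    exact pow_le_pow_left₀ dist_nonneg (dist_le_diameter p k j) 2
  have hsD : s ≤ D := abs_le_of_sq_le_sq' (by nlinarith) hD.le |>.2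
  have hs0 : D - s ≤ D := abs_le_of_sq_le_sq' (by nlinarith) hD.le |>.2
  set c := Real.cos (φ - θ)
  set σ := Real.sin (φ - θ)
  have hcσ : |σ| ^ 2 + |c| ^ 2 = 1 := by
    rw [sq_abs, sq_abs]; exact Real.sin_sq_add_cos_sq _
  have h1 : D * |c| ≤ extentAngle p φ := by
    have := abs_inner_le_extentAngle p j i φ
    rwa [hij, inner_smul_dir_dir, abs_mul, abs_of_pos hD, ← Real.cos_neg, neg_sub] at this
  have hi := abs_inner_le_extentAngle p k i φ
  have hj := abs_inner_le_extentAngle p k j φ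
  rw [inner_dir_eq _ θ φ, ← hs, ← hy] at hi
  rw [inner_dir_eq _ θ φ, e1, e2] at hj
  -- the end of the diametrical pair is chosen for which the two contributions add up
  rcases le_total 0 (c * (σ * y)) with hsign | hsign
  · refine altitude_le_extent (s := s) hD (abs_nonneg y) (abs_nonneg c) (abs_nonneg σ) hcσ
      hsD (by rwa [sq_abs]) h1 (le_trans (le_of_eq ?_) hi)
    rw [(abs_add_eq_add_abs_iff (c * s) (σ * y)).2, abs_mul, abs_mul, abs_of_nonneg
      (by linarith : 0 ≤ s)]
    · ring
    · rcases le_total 0 c with h | h <;> rcases le_total 0 (σ * y) with h' | h'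
      · exact Or.inl ⟨mul_nonneg h (by linarith), h'⟩
      · rcases h.eq_or_lt with h | h
        · exact Or.inr ⟨by rw [← h]; simp, h'⟩
        · exact Or.inl ⟨mul_nonneg h.le (by linarith), by nlinarith⟩
      · rcases h.eq_or_lt with h | h
        · exact Or.inl ⟨by rw [h]; simp, h'⟩
        · exact Or.inr ⟨mul_nonpos_of_nonpos_of_nonneg h.le (by linarith), by nlinarith⟩
      · exact Or.inr ⟨mul_nonpos_of_nonpos_of_nonneg h (by linarith), h'⟩
  · refine altitude_le_extent (s := D - s) hD (abs_nonneg y) (abs_nonneg c) (abs_nonneg σ) hcσ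
      hs0 (by rw [sub_sub_cancel, sq_abs]; exact hki) h1 (le_trans (le_of_eq ?_) hj)
    rw [(abs_add_eq_add_abs_iff (c * (s - D)) (σ * y)).2, abs_mul, abs_mul, abs_of_nonpos
      (by linarith : s - D ≤ 0)]
    · ring
    · rcases le_total 0 c with h | h <;> rcases le_total 0 (σ * y) with h' | h'
      · rcases h.eq_or_lt with h | h
        · exact Or.inl ⟨by rw [← h]; simp, h'⟩
        · exact Or.inr ⟨mul_nonpos_of_nonneg_of_nonpos h.le (by linarith), by nlinarith⟩
      · exact Or.inr ⟨mul_nonpos_of_nonneg_of_nonpos h (by linarith), h'⟩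
      · exact Or.inl ⟨mul_nonneg_of_nonpos_of_nonpos h (by linarith), h'⟩
      · rcases h.eq_or_lt with h | h
        · exact Or.inr ⟨by rw [h]; simp, h'⟩
        · exact Or.inl ⟨mul_nonneg_of_nonpos_of_nonpos h.le (by linarith), by nlinarith⟩

/-- The strip along a diametrical pair is at most twice as wide as the thinnest strip. -/
theorem IsDiametricAngle.extentAngle_le_two_mul {p : Fin n → Plane} {θ : ℝ}
    (h : IsDiametricAngle p θ) (hD : 0 < diameter p) (φ : ℝ) :
    extentAngle p (θ + Real.pi / 2) ≤ 2 * extentAngle p φ := by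
  have := nonempty_of_diameter_pos hD
  obtain ⟨i, j, -, hij⟩ := h
  refine extentAngle_le fun k l => ?_
  have e : inner ℝ (p k - p l) (dir (θ + Real.pi / 2)) =
      inner ℝ (p k - p i) (dir (θ + Real.pi / 2)) -
      inner ℝ (p l - p i) (dir (θ + Real.pi / 2)) := by
    rw [← inner_sub_left]; congr 1; abel
  have hk := abs_le.1 (abs_inner_le_of_diametric hD hij k φ)
  have hl := abs_le.1 (abs_inner_le_of_diametric hD hij l φ)
  linarith

theorem diameter_sq_le [Nonempty (Fin n)] (p : Fin n → Plane) (φ : ℝ) :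
    diameter p ^ 2 ≤ extentAngle p φ ^ 2 + extentAngle p (φ + Real.pi / 2) ^ 2 := by
  obtain ⟨i, j, hij⟩ := exists_dist_eq_diameter p
  rw [← hij, dist_eq_norm, ← inner_dir_sq_add_sq _ φ]
  gcongr ?_ + ?_ <;> exact sq_le_sq' (neg_le_of_abs_le (abs_inner_le_extentAngle p i j _))
    (inner_le_extentAngle p i j _)

/-- A bounding box with one side at least `7 / 10` of the diameter `D` and the other at least half
of the width `W` of the strip along a diametrical pair. -/
theorem IsDiametricAngle.obb_lower_bound {p : Fin n → Plane} {θ : ℝ}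
    (h : IsDiametricAngle p θ) (hD : 0 < diameter p) (φ : ℝ) :
    7 / 20 * (diameter p * extentAngle p (θ + Real.pi / 2)) ≤
      extentAngle p φ * extentAngle p (φ + Real.pi / 2) := by
  have := nonempty_of_diameter_pos hD
  have h1 := h.extentAngle_le_two_mul hD φ
  have h2 := h.extentAngle_le_two_mul hD (φ + Real.pi / 2)
  have h3 := diameter_sq_le p φ
  have hu := extentAngle_nonneg p φ
  have hv := extentAngle_nonneg p (φ + Real.pi / 2)
  have hW := extentAngle_nonneg p (θ + Real.pi / 2)
  set u := extentAngle p φ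
  set v := extentAngle p (φ + Real.pi / 2)
  set W := extentAngle p (θ + Real.pi / 2)
  set D := diameter p
  rcases le_total v u with huv | huv
  · have : 7 / 10 * D ≤ u := abs_le_of_sq_le_sq' (by nlinarith) hu |>.2
    calc 7 / 20 * (D * W) = (7 / 10 * D) * (W / 2) := by ring
      _ ≤ u * v := by gcongr; linarith
  · have : 7 / 10 * D ≤ v := abs_le_of_sq_le_sq' (by nlinarith) hv |>.2
    calc 7 / 20 * (D * W) = (W / 2) * (7 / 10 * D) := by ring
      _ ≤ u * v := by gcongr; linarith

/-! ### Costs of the orientations within the tolerance -/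

theorem lt_sin_pi_div_sixteen : 19 / 100 < Real.sin (Real.pi / 16) := by
  have h1 := Real.pi_gt_d2
  have h2 := Real.pi_lt_d2
  have h := Real.sin_gt_sub_cube (x := Real.pi / 16) (by linarith)
  have h3 : (Real.pi / 16) ^ 3 ≤ (3.15 / 16) ^ 3 := by gcongr
  norm_num at h1 h2 h3
  linarith

/-- The diametric box with angle `θ` is thin: not all orientations are tolerated. -/
def IsThin (p : Fin n → Plane) (θ : ℝ) : Prop := aspectRatio p θ < Real.sin (Real.pi / 16)

theorem tolerance_lt_iff (z : ℝ) : tolerance z < Real.pi / 2 ↔ z < Real.sin (Real.pi / 16) := by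
  have := Real.pi_pos
  rw [tolerance, ← Real.arcsin_lt_iff_lt_sin' ⟨by linarith, by linarith⟩]
  constructor <;> intro h <;> linarith

/-- Within the angle `arcsin z` of a diametrical pair the covering strip is at most twice as wide as
the strip along the pair. -/
theorem extentAngle_perp_le_two_mul {p : Fin n → Plane} {θ β : ℝ}
    (hD : 0 < diameter p) {m : ℤ}
    (hβ : |β - (θ + m * Real.pi)| ≤ Real.arcsin (aspectRatio p θ)) :
    extentAngle p (β + Real.pi / 2) ≤ 2 * extentAngle p (θ + Real.pi / 2) := by
  have := nonempty_of_diameter_pos hD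
  have hz := aspectRatio_nonneg hD θ
  set x := β - (θ + m * Real.pi) with hx
  have hper : extentAngle p (β + Real.pi / 2) = extentAngle p (θ + x + Real.pi / 2) := by
    rw [show θ + x + Real.pi / 2 = β + Real.pi / 2 - m * Real.pi by rw [hx]; ring,
      (extentAngle_periodic p).sub_int_mul_eq]
  have hrot := extentAngle_le_cos_add_sin p (θ + Real.pi / 2) (θ + x + Real.pi / 2)
  rw [show θ + x + Real.pi / 2 - (θ + Real.pi / 2) = x by ring] at hrot
  have hsin : |Real.sin x| ≤ aspectRatio p θ := by
    have h2 := Real.arcsin_le_pi_div_two (aspectRatio p θ)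
    by_cases hz1 : aspectRatio p θ ≤ 1
    · rw [Real.abs_sin_eq_sin_abs_of_abs_le_pi (by linarith [Real.pi_pos])]
      calc Real.sin |x| ≤ Real.sin (Real.arcsin (aspectRatio p θ)) :=
            Real.sin_le_sin_of_le_of_le_pi_div_two (by linarith [abs_nonneg x, Real.pi_pos]) h2 hβ
        _ = _ := Real.sin_arcsin (by linarith) hz1
    · exact (Real.abs_sin_le_one _).trans (by linarith)
  rw [hper]
  refine hrot.trans ?_
  rw [two_mul]
  gcongr
  · exact mul_le_of_le_one_left (extentAngle_nonneg _ _) (Real.abs_cos_le_one _)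
  · rw [← aspectRatio_mul_diameter hD θ]
    exact mul_le_mul hsin (extentAngle_le_diameter p _) (extentAngle_nonneg _ _) hz

section Costs

variable {p : Fin n → Plane} {θ β : ℝ}

theorem IsDiametricAngle.strip_le (h : IsDiametricAngle p θ) (hD : 0 < diameter p)
    (hβ : IsThin p θ → ∃ m : ℤ, |β - (θ + m * Real.pi)| ≤ Real.arcsin (aspectRatio p θ))
    (φ : ℝ) : extentAngle p (β + Real.pi / 2) ≤ 18 * extentAngle p φ := by
  have := nonempty_of_diameter_pos hD
  have hω := h.extentAngle_le_two_mul hD φ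
  have hφ := extentAngle_nonneg p φ
  by_cases hthin : IsThin p θ
  · obtain ⟨m, hm⟩ := hβ hthin
    have := extentAngle_perp_le_two_mul hD hm
    linarith
  · have hz : 19 / 100 ≤ aspectRatio p θ := lt_sin_pi_div_sixteen.le.trans (not_lt.1 hthin)
    have h1 := extentAngle_le_diameter p (β + Real.pi / 2)
    have h2 := mul_le_mul_of_nonneg_right hz hD.le
    rw [aspectRatio_mul_diameter hD] at h2
    linarith

theorem IsDiametricAngle.obb_le (h : IsDiametricAngle p θ) (hD : 0 < diameter p)
    (hβ : IsThin p θ → ∃ m : ℤ, |β - (θ + m * Real.pi)| ≤ Real.arcsin (aspectRatio p θ))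
    (φ : ℝ) : extentAngle p β * extentAngle p (β + Real.pi / 2) ≤
      18 * (extentAngle p φ * extentAngle p (φ + Real.pi / 2)) := by
  have := nonempty_of_diameter_pos hD
  have hlow := h.obb_lower_bound hD φ
  have hW := extentAngle_nonneg p (θ + Real.pi / 2)
  have h1 := extentAngle_le_diameter p β
  have hβ1 := extentAngle_nonneg p (β + Real.pi / 2)
  by_cases hthin : IsThin p θ
  · obtain ⟨m, hm⟩ := hβ hthin
    have h2 := mul_le_mul h1 (extentAngle_perp_le_two_mul hD hm) hβ1 hD.le
    nlinarith [mul_nonneg hD.le hW]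
  · have hz : 19 / 100 ≤ aspectRatio p θ := lt_sin_pi_div_sixteen.le.trans (not_lt.1 hthin)
    have h2 := mul_le_mul h1 (extentAngle_le_diameter p (β + Real.pi / 2)) hβ1 hD.le
    have h3 := mul_le_mul_of_nonneg_right hz hD.le
    rw [aspectRatio_mul_diameter hD] at h3
    nlinarith [mul_le_mul_of_nonneg_left h3 hD.le, mul_nonneg hD.le hW]

end Costs

/-! ### Real representatives of orientations -/

/-- The representative modulo `π` of `x` that is nearest to `c`. -/
def nearestLift (x c : ℝ) : ℝ := x - round ((x - c) / Real.pi) * Real.pi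

theorem exists_nearestLift_eq (x c : ℝ) : ∃ m : ℤ, nearestLift x c = x + m * Real.pi :=
  ⟨-round ((x - c) / Real.pi), by rw [nearestLift]; push_cast; ring⟩

theorem abs_nearestLift_sub_le_of_lift (x c : ℝ) (m : ℤ) :
    |nearestLift x c - c| ≤ |x + m * Real.pi - c| := by
  have h := round_le ((x - c) / Real.pi) (-m)
  have hpi := Real.pi_pos
  have e (k : ℤ) : |(x - c) / Real.pi - k| * Real.pi = |x - c - k * Real.pi| := by
    rw [← abs_of_pos hpi, ← abs_mul, abs_of_pos hpi, sub_mul, div_mul_cancel₀ _ hpi.ne']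
  have h' := mul_le_mul_of_nonneg_right h hpi.le
  rw [e, e] at h'
  have e1 : nearestLift x c - c = x - c - round ((x - c) / Real.pi) * Real.pi := by
    unfold nearestLift; ring
  have e2 : x + m * Real.pi - c = x - c - ((-m : ℤ) : ℝ) * Real.pi := by push_cast; ring
  rwa [e1, e2]

theorem abs_nearestLift_sub_le (x c : ℝ) : |nearestLift x c - c| ≤ Real.pi / 2 := by
  have h := abs_sub_round ((x - c) / Real.pi)
  have hpi := Real.pi_pos
  have h' := mul_le_mul_of_nonneg_right h hpi.le
  rw [← abs_of_pos hpi, ← abs_mul, abs_of_pos hpi, sub_mul, div_mul_cancel₀ _ hpi.ne'] at h'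
  rw [nearestLift, sub_right_comm]
  linarith

theorem int_eq_of_abs_lift_sub_lt {x : ℝ} {m m' : ℤ}
    (h : |x + m * Real.pi - (x + m' * Real.pi)| < Real.pi) : m = m' := by
  rw [add_sub_add_left_eq_sub, ← sub_mul, abs_mul, abs_of_pos Real.pi_pos] at h
  have h1 : |((m - m' : ℤ) : ℝ)| < 1 := by
    push_cast
    exact lt_of_mul_lt_mul_right (by linarith) Real.pi_pos.le
  rw [← Int.cast_abs] at h1
  have h2 : |m - m'| < 1 := by exact_mod_cast h1
  rw [Int.abs_lt_one_iff] at h2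
  linarith

theorem nearestLift_eq_of_abs_lt {x c : ℝ} {m : ℤ} (h : |x + m * Real.pi - c| < Real.pi / 2) :
    nearestLift x c = x + m * Real.pi := by
  obtain ⟨k, hk⟩ := exists_nearestLift_eq x c
  have h1 := abs_nearestLift_sub_le x c
  rw [hk] at h1 ⊢
  rw [int_eq_of_abs_lift_sub_lt (x := x) (m := k) (m' := m)]
  rw [abs_lt] at h ⊢
  rw [abs_le] at h1
  constructor <;> linarith

theorem nearestLift_self (x : ℝ) : nearestLift x x = x := by simp [nearestLift]

theorem measurable_nearestLift (c : ℝ) : Measurable fun x => nearestLift x c := by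
  unfold nearestLift
  simp only [round_eq]
  have : Measurable fun x : ℝ => ((⌊(x - c) / Real.pi + 1 / 2⌋ : ℤ) : ℝ) :=
    (measurable_from_top (f := fun k : ℤ => (k : ℝ))).comp
      (Int.measurable_floor.comp (by fun_prop))
  exact measurable_id.sub (this.mul_const _)

theorem exists_lift_of_abs_sin_le {x A : ℝ} (hA0 : 0 ≤ A) (h : |Real.sin x| ≤ Real.sin A) :
    ∃ m : ℤ, |x + m * Real.pi| ≤ A := by
  obtain ⟨m, hm⟩ := exists_nearestLift_eq x 0
  have h1 := abs_nearestLift_sub_le x 0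
  rw [hm, sub_zero] at h1
  refine ⟨m, ?_⟩
  by_contra! hlt
  have h2 : |Real.sin (x + m * Real.pi)| = |Real.sin x| := by
    rw [Real.sin_add_int_mul_pi, abs_mul, abs_neg_one_zpow, one_mul]
  rw [Real.abs_sin_eq_sin_abs_of_abs_le_pi (by linarith [Real.pi_pos])] at h2
  have h3 : Real.sin A < Real.sin |x + m * Real.pi| :=
    Real.sin_lt_sin_of_lt_of_le_pi_div_two (by linarith [Real.pi_pos]) h1 hlt
  linarith

/-! ### Change of the diametrical orientations over a short time -/

/-- A motion for all times with points of at most unit speed and diameter at least `1`. -/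
structure IsSteady {n : ℕ} (Q : Motion n) : Prop where
  lipschitz : ∀ i, LipschitzWith 1 (fun t => Q t i)
  one_le_diameter : ∀ t, 1 ≤ diameter (Q t)

variable {Q Q' : Motion n}

theorem IsSteady.diameter_pos (hQ : IsSteady Q) (t : ℝ) : 0 < diameter (Q t) :=
  zero_lt_one.trans_le (hQ.one_le_diameter t)

theorem IsSteady.nonempty (hQ : IsSteady Q) : Nonempty (Fin n) :=
  nonempty_of_diameter_pos (hQ.diameter_pos 0)

theorem IsSteady.continuous (hQ : IsSteady Q) : Continuous Q :=
  continuous_pi fun i => (hQ.lipschitz i).continuous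

theorem IsSteady.dist_le (hQ : IsSteady Q) (s t : ℝ) (i : Fin n) :
    dist (Q s i) (Q t i) ≤ |s - t| := by
  simpa [Real.dist_eq] using (hQ.lipschitz i).dist_le_mul s t

/-- A strip that covers the points at time `t` covers those at time `s` when widened by
`2 * |s - t|`; in relation to the diameter this is a little more, as the diameter changes too. -/
theorem IsSteady.extentAngle_le (hQ : IsSteady Q) {s t φ c : ℝ} (hc : 0 ≤ c)
    (h : extentAngle (Q t) φ ≤ c * diameter (Q t)) :
    extentAngle (Q s) φ ≤ (c + (2 + 2 * c) * |s - t|) * diameter (Q s) := by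
  have := hQ.nonempty
  have h1 := extentAngle_le_add (hQ.dist_le s t) φ
  have h2 := diameter_le_add (abs_nonneg (t - s)) (hQ.dist_le t s)
  rw [abs_sub_comm] at h2
  have h3 := mul_le_mul_of_nonneg_left h2 hc
  have h4 : (2 + 2 * c) * |s - t| * 1 ≤ (2 + 2 * c) * |s - t| * diameter (Q s) :=
    mul_le_mul_of_nonneg_left (hQ.one_le_diameter s) (by positivity)
  linarith

theorem arcsin_le_of_isThin {p : Fin n → Plane} {θ : ℝ} (h : IsThin p θ) :
    Real.arcsin (aspectRatio p θ) ≤ Real.pi / 16 :=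
  (Real.arcsin_le_iff_le_sin' ⟨by linarith [Real.pi_pos], by linarith [Real.pi_pos]⟩).2 h.le

theorem sin_pi_div_sixteen_lt : Real.sin (Real.pi / 16) < 197 / 1000 := by
  have h := Real.sin_lt (x := Real.pi / 16) (by positivity)
  have h2 := Real.pi_lt_d2
  linarith

theorem add_le_sin_arcsin_add {z s : ℝ} (hz0 : 0 ≤ z) (hz : z ≤ Real.sin (Real.pi / 16))
    (hs0 : 0 ≤ s) (hs : s ≤ 1 / 10) : z + 12 / 5 * s ≤ Real.sin (Real.arcsin z + 3 * s) := by
  have hz1 := hz.trans sin_pi_div_sixteen_lt.le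
  have hcos : 49 / 50 ≤ Real.cos (Real.arcsin z) := by
    rw [Real.cos_arcsin]
    exact Real.le_sqrt_of_sq_le (by nlinarith)
  rw [Real.sin_add, Real.sin_arcsin (by linarith) (by linarith)]
  have h1 := Real.one_sub_sq_div_two_le_cos (x := 3 * s)
  have h2 : 19 / 20 * (3 * s) ≤ Real.sin (3 * s) := by
    rcases hs0.eq_or_lt with rfl | hs0
    · simp
    · have := Real.sin_gt_sub_cube (x := 3 * s) (by linarith)
      nlinarith [mul_nonneg hs0.le (mul_nonneg hs0.le hs0.le), mul_le_mul hs hs hs0.le (by norm_num)]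
  have h3 := mul_le_mul_of_nonneg_left h1 hz0
  have h4 := mul_le_mul hcos h2 (by positivity) (by linarith)
  nlinarith [mul_nonneg hs0 hs0, mul_nonneg hz0 hs0, mul_nonneg hz0 (mul_nonneg hs0 hs0),
    mul_le_mul hz1 hs hs0 (by norm_num), mul_le_mul_of_nonneg_left hs (mul_nonneg hz0 hs0)]

theorem IsSteady.extentAngle_le_of_isThin (hQ : IsSteady Q) {s t θ : ℝ} (hthin : IsThin (Q t) θ)
    (hst : s ≤ t) :
    extentAngle (Q s) (θ + Real.pi / 2) ≤
      (aspectRatio (Q t) θ + 12 / 5 * (t - s)) * diameter (Q s) := by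
  have hz := aspectRatio_nonneg (hQ.diameter_pos t) θ
  have hz1 := hthin.le.trans sin_pi_div_sixteen_lt.le
  have h := hQ.extentAngle_le (s := s) hz (aspectRatio_mul_diameter (hQ.diameter_pos t) θ).ge
  rw [abs_sub_comm, abs_of_nonneg (sub_nonneg.2 hst)] at h
  refine h.trans (mul_le_mul_of_nonneg_right ?_ (hQ.diameter_pos s).le)
  have := mul_le_mul_of_nonneg_right hz1 (sub_nonneg.2 hst)
  linarith

/-- If the diametric box with angle `θ` is thin, then shortly before all diametrical orientations
are near `θ`. -/
theorem IsSteady.exists_lift_near (hQ : IsSteady Q) {s t θ θ' : ℝ} (hthin : IsThin (Q t) θ)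
    (hst : s ≤ t) (hs : t - 1 / 10 ≤ s) (hθ' : IsDiametricAngle (Q s) θ') :
    ∃ m : ℤ, |θ' + m * Real.pi - θ| ≤ Real.arcsin (aspectRatio (Q t) θ) + 3 * (t - s) := by
  have hz := aspectRatio_nonneg (hQ.diameter_pos t) θ
  have h1 := (hθ'.diameter_mul_abs_sin_le θ).trans (hQ.extentAngle_le_of_isThin hthin hst)
  rw [mul_comm] at h1
  have h2 := le_of_mul_le_mul_right h1 (hQ.diameter_pos s)
  have h3 := add_le_sin_arcsin_add hz hthin.le (sub_nonneg.2 hst) (by linarith)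
  obtain ⟨m, hm⟩ := exists_lift_of_abs_sin_le
    (by have := Real.arcsin_nonneg.2 hz; linarith) (h2.trans h3)
  exact ⟨m, by rwa [add_sub_right_comm]⟩

/-- The points are covered by a strip of width at most `11 / 25` of the diameter. The constant is
such that this is so for a tenth of a time unit before the diametric box is thin. -/
def IsFlat (p : Fin n → Plane) : Prop :=
  ∃ ψ : ℝ, extentAngle p (ψ + Real.pi / 2) ≤ 11 / 25 * diameter p

theorem IsSteady.isFlat_of_isThin (hQ : IsSteady Q) {s t θ : ℝ} (hthin : IsThin (Q t) θ)
    (hst : s ≤ t) (hs : t - 1 / 10 ≤ s) : IsFlat (Q s) := by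
  refine ⟨θ, (hQ.extentAngle_le_of_isThin hthin hst).trans
    (mul_le_mul_of_nonneg_right ?_ (hQ.diameter_pos s).le)⟩
  have hz1 := hthin.le.trans sin_pi_div_sixteen_lt.le
  linarith

/-- Shortly after a point set is flat, all diametrical orientations are at less than a right
angle. -/
theorem IsSteady.abs_nearestLift_sub_lt (hQ : IsSteady Q) {s t θ θ' : ℝ} (hflat : IsFlat (Q s))
    (hst : s ≤ t) (ht : t ≤ s + 1 / 20) (hθ : IsDiametricAngle (Q s) θ)
    (hθ' : IsDiametricAngle (Q t) θ') : |nearestLift θ' θ - θ| < Real.pi / 2 := by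
  obtain ⟨ψ, hψ⟩ := hflat
  have hψ' := hQ.extentAngle_le (s := t) (by norm_num) hψ
  rw [abs_of_nonneg (sub_nonneg.2 hst)] at hψ'
  have hA0 : 0 ≤ Real.arcsin (3 / 5) := Real.arcsin_nonneg.2 (by norm_num)
  have hA : Real.arcsin (3 / 5) < Real.pi / 4 := by
    rw [Real.arcsin_lt_iff_lt_sin' ⟨by linarith [Real.pi_pos], by linarith [Real.pi_pos]⟩,
      Real.sin_pi_div_four]
    have : (1.4 : ℝ) ≤ √2 := Real.le_sqrt_of_sq_le (by norm_num)
    linarith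
  have hsin : Real.sin (Real.arcsin (3 / 5)) = 3 / 5 :=
    Real.sin_arcsin (by norm_num) (by norm_num)
  have key {r α : ℝ} (hα : IsDiametricAngle (Q r) α)
      (h : extentAngle (Q r) (ψ + Real.pi / 2) ≤ 3 / 5 * diameter (Q r)) :
      ∃ m : ℤ, |α - ψ + m * Real.pi| ≤ Real.arcsin (3 / 5) := by
    refine exists_lift_of_abs_sin_le hA0 ?_
    rw [hsin]
    refine le_of_mul_le_mul_right ?_ (hQ.diameter_pos r)
    rw [mul_comm]
    exact (hα.diameter_mul_abs_sin_le ψ).trans h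
  obtain ⟨m, hm⟩ := key hθ (hψ.trans
    (mul_le_mul_of_nonneg_right (by norm_num) (hQ.diameter_pos s).le))
  obtain ⟨m', hm'⟩ := key hθ' (hψ'.trans
    (mul_le_mul_of_nonneg_right (by linarith) (hQ.diameter_pos t).le))
  refine (abs_nearestLift_sub_le_of_lift θ' θ (m' - m)).trans_lt ?_
  have e : θ' + ((m' - m : ℤ) : ℝ) * Real.pi - θ =
      (θ' - ψ + m' * Real.pi) - (θ - ψ + m * Real.pi) := by push_cast; ring
  rw [e]
  refine (abs_sub _ _).trans_lt ?_
  linarith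

/-! ### The chasing algorithm -/

/-- The real target in the time step that starts at time `k / 20`, for an output represented by `x`
at that time. If the points are flat then, it is the representative of a diametrical orientation
that is nearest to the one chosen at the start of the step, which in turn is nearest to `x`.
Otherwise no orientation is excluded during the step, and the output rotates in the positive
direction, towards a point that it does not reach. -/
def stepTarget (Q : Motion n) (k : ℕ) (x t : ℝ) : ℝ :=
  open scoped Classical in
  if IsFlat (Q (k / 20)) then
    nearestLift (diametricAngle (Q t)) (nearestLift (diametricAngle (Q (k / 20))) x)
  else x + 3

theorem IsSteady.measurable_stepTarget (hQ : IsSteady Q) (k : ℕ) (x : ℝ) :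
    Measurable (stepTarget Q k x) := by
  unfold stepTarget
  split_ifs
  · exact (measurable_nearestLift _).comp
      (measurable_diametricAngle.comp hQ.continuous.measurable)
  · exact measurable_const

/-- A pursuit, at speed `43`, of the target `Θ` from the position `c` at time `a`, if there is
one. -/
def pursuit (Θ : ℝ → ℝ) (a c : ℝ) : ℝ → ℝ :=
  open scoped Classical in
  if h : ∃ b, IsPursuit 43 Θ a b ∧ b a = c then h.choose else 0

theorem isPursuit_pursuit {Θ : ℝ → ℝ} (hΘ : Measurable Θ) (a c : ℝ) :
    IsPursuit 43 Θ a (pursuit Θ a c) ∧ pursuit Θ a c a = c := by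
  have h := exists_isPursuit 43 hΘ a c
  rw [pursuit, dif_pos h]
  exact h.choose_spec

/-- The real angle of the output at time `k / 20`. -/
def gridValue (Q : Motion n) : ℕ → ℝ
  | 0 => diametricAngle (Q 0)
  | k + 1 => pursuit (stepTarget Q k (gridValue Q k)) (k / 20) (gridValue Q k) ((k + 1 : ℕ) / 20)

/-- The real angle that the output moves towards. -/
def chaseTarget (Q : Motion n) (t : ℝ) : ℝ :=
  stepTarget Q ⌊20 * t⌋₊ (gridValue Q ⌊20 * t⌋₊) t

/-- The real angle of the output. -/
def chase (Q : Motion n) : ℝ → ℝ := pursuit (chaseTarget Q) 0 (diametricAngle (Q 0))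

theorem IsSteady.measurable_chaseTarget (hQ : IsSteady Q) : Measurable (chaseTarget Q) := by
  have h : Measurable fun q : ℕ × ℝ => stepTarget Q q.1 (gridValue Q q.1) q.2 :=
    measurable_from_prod_countable_right fun k => hQ.measurable_stepTarget k (gridValue Q k)
  have hfloor : Measurable fun t : ℝ => (⌊20 * t⌋₊, t) :=
    (Nat.measurable_floor.comp (measurable_id.const_mul 20)).prodMk measurable_id
  have e : chaseTarget Q = (fun q : ℕ × ℝ => stepTarget Q q.1 (gridValue Q q.1) q.2) ∘
      fun t : ℝ => (⌊20 * t⌋₊, t) := rfl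
  rw [e]
  exact h.comp hfloor

theorem IsSteady.isPursuit_chase (hQ : IsSteady Q) : IsPursuit 43 (chaseTarget Q) 0 (chase Q) :=
  (isPursuit_pursuit hQ.measurable_chaseTarget _ _).1

theorem IsSteady.chase_zero (hQ : IsSteady Q) : chase Q 0 = diametricAngle (Q 0) :=
  (isPursuit_pursuit hQ.measurable_chaseTarget _ _).2

theorem floor_eq_of_mem_Ico {k : ℕ} {t : ℝ} (ht : t ∈ Ico ((k : ℝ) / 20) ((k + 1 : ℕ) / 20)) :
    ⌊20 * t⌋₊ = k := by
  have h1 := ht.1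
  have h2 := ht.2
  push_cast at h2
  rw [Nat.floor_eq_iff (by have : (0 : ℝ) ≤ k := Nat.cast_nonneg k; linarith)]
  constructor <;> linarith

theorem IsSteady.chase_eq_gridValue (hQ : IsSteady Q) (k : ℕ) :
    chase Q (k / 20) = gridValue Q k := by
  induction k with
  | zero => simpa [gridValue] using hQ.chase_zero
  | succ k ih =>
    have h := isPursuit_pursuit (hQ.measurable_stepTarget k (gridValue Q k)) (k / 20) (gridValue Q k)
    refine (hQ.isPursuit_chase.mono_start (by positivity)).eq_of_eqOn h.1
      (by push_cast; linarith) (fun s hs => ?_) (ih.trans h.2.symm)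
    rw [chaseTarget, floor_eq_of_mem_Ico hs]

theorem IsSteady.chaseTarget_eq (hQ : IsSteady Q) {k : ℕ} {t : ℝ}
    (ht : t ∈ Ico ((k : ℝ) / 20) ((k + 1 : ℕ) / 20)) :
    chaseTarget Q t = stepTarget Q k (chase Q (k / 20)) t := by
  rw [chaseTarget, floor_eq_of_mem_Ico ht, hQ.chase_eq_gridValue]

/-- The output depends only on the past of the motion. -/
theorem IsSteady.chase_congr (hQ : IsSteady Q) (hQ' : IsSteady Q') {t : ℝ} (ht : 0 ≤ t)
    (h : ∀ s ∈ Icc 0 t, Q s = Q' s) : chase Q t = chase Q' t := by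
  have hstep (k : ℕ) (x s : ℝ) (hks : (k : ℝ) / 20 ≤ s) (hst : s ≤ t) :
      stepTarget Q k x s = stepTarget Q' k x s := by
    have hk : (0 : ℝ) ≤ (k : ℝ) / 20 := by positivity
    rw [stepTarget, stepTarget, h _ ⟨hk, hks.trans hst⟩, h _ ⟨hk.trans hks, hst⟩]
  have hgrid (k : ℕ) (hk : (k : ℝ) / 20 ≤ t) : gridValue Q k = gridValue Q' k := by
    induction k with
    | zero => rw [gridValue, gridValue, h 0 ⟨le_rfl, ht⟩]
    | succ k ih =>
      have hle : (k : ℝ) / 20 ≤ (k + 1 : ℕ) / 20 := by push_cast; linarith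
      have h1 := isPursuit_pursuit (hQ.measurable_stepTarget k (gridValue Q k)) (k / 20)
        (gridValue Q k)
      have h2 := isPursuit_pursuit (hQ'.measurable_stepTarget k (gridValue Q' k)) (k / 20)
        (gridValue Q' k)
      have e := ih (hle.trans hk)
      refine h1.1.eq_of_eqOn h2.1 hle (fun s hs => ?_) (by rw [h1.2, h2.2, e])
      rw [hstep k _ s hs.1 (hs.2.le.trans hk), e]
  refine hQ.isPursuit_chase.eq_of_eqOn hQ'.isPursuit_chase ht (fun s hs => ?_)
    (by rw [hQ.chase_zero, hQ'.chase_zero, h 0 ⟨le_rfl, ht⟩])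
  have hfl : ((⌊20 * s⌋₊ : ℕ) : ℝ) / 20 ≤ s := by
    have := Nat.floor_le (show 0 ≤ 20 * s by linarith [hs.1])
    linarith
  rw [chaseTarget, chaseTarget, hgrid _ (hfl.trans hs.2.le), hstep _ _ s hfl hs.2.le]

/-! ### The output stays within the tolerance -/

theorem exists_mem_Ico_step {t : ℝ} (ht : 0 ≤ t) :
    ∃ k : ℕ, t ∈ Ico ((k : ℝ) / 20) ((k + 1 : ℕ) / 20) := by
  refine ⟨⌊20 * t⌋₊, ?_, ?_⟩
  · have := Nat.floor_le (show 0 ≤ 20 * t by linarith)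
    linarith
  · have := Nat.lt_floor_add_one (20 * t)
    push_cast
    linarith

/-- In a step that starts shortly before the diametric box with angle `θ` is thin, all targets are
near the same representative of `θ`. -/
theorem IsSteady.exists_step_lift_near (hQ : IsSteady Q) {t θ : ℝ} (hthin : IsThin (Q t) θ)
    (k : ℕ) (x : ℝ) (hkt : (k : ℝ) / 20 ≤ t) (hk : t - 1 / 10 ≤ (k : ℝ) / 20) :
    ∃ m : ℤ, |nearestLift (diametricAngle (Q (k / 20))) x - (θ + m * Real.pi)| ≤
        Real.arcsin (aspectRatio (Q t) θ) + 3 * (t - k / 20) ∧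
      ∀ s ∈ Icc ((k : ℝ) / 20) t, |stepTarget Q k x s - (θ + m * Real.pi)| ≤
        Real.arcsin (aspectRatio (Q t) θ) + 3 * (t - s) := by
  have := hQ.nonempty
  have hpi := Real.pi_gt_d2
  have hA := arcsin_le_of_isThin hthin
  have hpi' := Real.pi_lt_d2
  set A := Real.arcsin (aspectRatio (Q t) θ)
  set r := nearestLift (diametricAngle (Q (k / 20))) x with hr
  obtain ⟨m₁, hm₁⟩ := exists_nearestLift_eq (diametricAngle (Q (k / 20))) x
  rw [← hr] at hm₁
  obtain ⟨m₂, hm₂⟩ := hQ.exists_lift_near hthin hkt hk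
    (isDiametricAngle_diametricAngle (Q (k / 20)))
  have hrm : |r - (θ + ((m₁ - m₂ : ℤ) : ℝ) * Real.pi)| ≤ A + 3 * (t - k / 20) := by
    convert hm₂ using 2
    rw [hm₁]; push_cast; ring
  refine ⟨m₁ - m₂, hrm, fun s hs => ?_⟩
  obtain ⟨m₃, hm₃⟩ := hQ.exists_lift_near hthin hs.2 (hk.trans hs.1)
    (isDiametricAngle_diametricAngle (Q s))
  have e : diametricAngle (Q s) + m₃ * Real.pi - θ = diametricAngle (Q s) +
      ((m₃ + (m₁ - m₂) : ℤ) : ℝ) * Real.pi - (θ + ((m₁ - m₂ : ℤ) : ℝ) * Real.pi) := by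
    push_cast; ring
  rw [e] at hm₃
  rw [stepTarget, if_pos (hQ.isFlat_of_isThin hthin hkt hk), ← hr, nearestLift_eq_of_abs_lt]
  · exact hm₃
  · have h1 := abs_le.1 hm₃
    have h2 := abs_le.1 hrm
    have h3 := hs.1
    rw [abs_lt]
    constructor <;> linarith

/-- While the diametric box is thin, output and target are within the angle `arcsin z` of the same
representative of the diametrical orientation. In a full step of length `1 / 20` before, the output
had time to come from an arbitrary orientation into the cone of diametrical orientations, which
shrinks to the angle `arcsin z` slower than the output moves. -/
theorem IsSteady.exists_abs_chase_sub_le (hQ : IsSteady Q) {t θ : ℝ} (ht : 0 ≤ t)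
    (hthin : IsThin (Q t) θ) :
    ∃ m : ℤ, |chase Q t - (θ + m * Real.pi)| ≤ Real.arcsin (aspectRatio (Q t) θ) ∧
      |chaseTarget Q t - (θ + m * Real.pi)| ≤ Real.arcsin (aspectRatio (Q t) θ) := by
  have hpi := Real.pi_gt_d2
  have hpi' := Real.pi_lt_d2
  have hA := arcsin_le_of_isThin hthin
  have hA0 := Real.arcsin_nonneg.2 (aspectRatio_nonneg (hQ.diameter_pos t) θ)
  set A := Real.arcsin (aspectRatio (Q t) θ)
  obtain ⟨k, hk⟩ := exists_mem_Ico_step ht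
  have hk1 := hk.1
  have hk2 := hk.2
  push_cast at hk2
  obtain ⟨m, hm, hstep⟩ := hQ.exists_step_lift_near hthin k (chase Q (k / 20)) hk.1
    (by linarith)
  have htarget := hstep t ⟨hk.1, le_rfl⟩
  rw [← hQ.chaseTarget_eq hk, sub_self, mul_zero, add_zero] at htarget
  -- it remains to see that the output is in the cone at the start of the step
  suffices hstart : |chase Q (k / 20) - (θ + m * Real.pi)| ≤ A + 3 * (t - k / 20) by
    refine ⟨m, ?_, htarget⟩
    refine (hQ.isPursuit_chase.mono_start (by positivity)).abs_sub_le hk.1 (fun s hs => ?_) ?_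
    · rw [hQ.chaseTarget_eq ⟨hs.1, hs.2.trans hk.2⟩]
      refine (hstep s ⟨hs.1, hs.2.le⟩).trans ?_
      simp only [NNReal.coe_ofNat]
      linarith [hs.2]
    · refine hstart.trans ?_
      simp only [NNReal.coe_ofNat]
      linarith
  have hr := abs_nearestLift_sub_le (diametricAngle (Q (k / 20))) (chase Q (k / 20))
  rcases k with _ | j
  · simp only [Nat.cast_zero, zero_div, hQ.chase_zero, nearestLift_self] at hm ⊢
    exact hm
  · have hj1 : (j : ℝ) / 20 = ((j + 1 : ℕ) : ℝ) / 20 - 1 / 20 := by push_cast; ring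
    set τ : ℝ := ((j + 1 : ℕ) : ℝ) / 20 with hτ
    have hτ2 : t < τ + 1 / 20 := by rw [hτ]; push_cast at hk2 ⊢; linarith
    obtain ⟨m', hm', hstep'⟩ := hQ.exists_step_lift_near hthin j (chase Q (j / 20))
      (by linarith) (by linarith)
    have hr' := abs_nearestLift_sub_le (diametricAngle (Q (j / 20))) (chase Q (j / 20))
    have hend : |chase Q τ - (θ + m' * Real.pi)| ≤ A + 3 * (t - τ) := by
      refine (hQ.isPursuit_chase.mono_start (a' := j / 20) (by positivity)).abs_sub_le
        (by linarith) (fun s hs => ?_) ?_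
      · rw [hQ.chaseTarget_eq hs]
        refine (hstep' s ⟨hs.1, hs.2.le.trans hk1⟩).trans ?_
        simp only [NNReal.coe_ofNat]
        linarith [hs.2]
      · simp only [NNReal.coe_ofNat]
        rw [abs_le] at hm' hr' ⊢
        constructor <;> linarith
    -- both steps aim at the same representative
    have : m' = m := by
      refine int_eq_of_abs_lift_sub_lt (x := θ) ?_
      rw [abs_le] at hend hm hr
      rw [abs_lt]
      constructor <;> linarith
    rwa [← this]

/-- The output chases the orientation of the diametrical pair. -/
theorem IsSteady.ae_chasesDiameterAt (hQ : IsSteady Q) :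
    ∀ᵐ t, 0 < t → ∀ β : ℝ → Orientation, (∀ᶠ s in 𝓝 t, ((chase Q s : ℝ) : Orientation) = β s) →
      ChasesDiameterAt 43 (Q t) β t := by
  have := hQ.nonempty
  have hpi := Real.pi_gt_d2
  filter_upwards [hQ.isPursuit_chase.ae_hasDerivAt] with t hderiv ht β hβ
  obtain ⟨k, hk⟩ := exists_mem_Ico_step ht.le
  have hk1 := hk.1
  have hk2 := hk.2
  push_cast at hk2
  have hpur := hQ.isPursuit_chase.mono_start (a' := (k : ℝ) / 20) (by positivity)
  by_cases hflat : IsFlat (Q (k / 20))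
  · set r := nearestLift (diametricAngle (Q (k / 20))) (chase Q (k / 20)) with hr
    have htar (s : ℝ) (hs : s ∈ Ico ((k : ℝ) / 20) ((k + 1 : ℕ) / 20)) :
        chaseTarget Q s = nearestLift (diametricAngle (Q s)) r := by
      rw [hQ.chaseTarget_eq hs, stepTarget, if_pos hflat]
    have hb : |chase Q t - r| ≤ Real.pi / 2 := by
      refine hpur.abs_sub_le hk1 (fun s hs => ?_) ?_
      · rw [htar s ⟨hs.1, hs.2.trans hk.2⟩]
        refine (abs_nearestLift_sub_le _ _).trans ?_
        simp only [NNReal.coe_ofNat]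
        linarith [hs.2]
      · rw [abs_sub_comm]
        refine (abs_nearestLift_sub_le _ _).trans ?_
        simp only [NNReal.coe_ofNat]
        linarith
    have hdr : IsDiametricAngle (Q (k / 20)) r := by
      obtain ⟨m, hm⟩ := exists_nearestLift_eq (diametricAngle (Q (k / 20))) (chase Q (k / 20))
      rw [hr, hm]
      exact (isDiametricAngle_diametricAngle _).add_int_mul_pi m
    have hlt := hQ.abs_nearestLift_sub_lt hflat hk1 (by linarith) hdr
      (isDiametricAngle_diametricAngle (Q t))
    rw [← htar t hk] at hlt
    have hdiam : IsDiametricAngle (Q t) (chaseTarget Q t) := by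
      obtain ⟨m, hm⟩ := exists_nearestLift_eq (diametricAngle (Q t)) r
      rw [htar t hk, hm]
      exact (isDiametricAngle_diametricAngle _).add_int_mul_pi m
    refine ⟨chaseTarget Q t, chase Q, hdiam, hβ, ?_, fun htol => ?_, fun hne => ?_⟩
    · rw [abs_le] at hb
      rw [abs_lt] at hlt ⊢
      constructor <;> linarith
    · have hthin : IsThin (Q t) (chaseTarget Q t) := (tolerance_lt_iff _).1 htol
      obtain ⟨m, h1, h2⟩ := hQ.exists_abs_chase_sub_le ht.le hthin
      have hA := arcsin_le_of_isThin hthin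
      rw [abs_le] at h1 h2 ⊢
      constructor <;> linarith
    · exact hderiv ht hne.symm
  · have htar : chaseTarget Q t = chase Q (k / 20) + 3 := by
      rw [hQ.chaseTarget_eq hk, stepTarget, if_neg hflat]
    have hb := hpur.lipschitz.dist_le_mul t (k / 20)
    rw [Real.dist_eq, Real.dist_eq, abs_of_nonneg (sub_nonneg.2 hk1)] at hb
    simp only [NNReal.coe_ofNat] at hb
    have hb' := (abs_le.1 hb).2
    have hpos : 0 < chaseTarget Q t - chase Q t := by linarith
    have hd := hderiv ht (by linarith : chase Q t < chaseTarget Q t).ne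
    rw [Real.sign_of_pos hpos] at hd
    -- the first representative of a diametrical orientation that is not behind the output
    set θ := diametricAngle (Q t)
    set m : ℤ := ⌈(chase Q t - θ) / Real.pi⌉
    have hm1 : chase Q t - θ ≤ m * Real.pi := (div_le_iff₀ Real.pi_pos).1 (Int.le_ceil _)
    have hm2 : m * Real.pi < chase Q t - θ + Real.pi := by
      have := mul_lt_mul_of_pos_right (Int.ceil_lt_add_one ((chase Q t - θ) / Real.pi)) Real.pi_pos
      rwa [add_mul, div_mul_cancel₀ _ Real.pi_pos.ne', one_mul] at this
    refine ⟨θ + m * Real.pi, chase Q, (isDiametricAngle_diametricAngle _).add_int_mul_pi m, hβ,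
      ?_, fun htol => ?_, fun hne => ?_⟩
    · rw [abs_of_nonneg (by linarith)]
      linarith
    · exact absurd (hQ.isFlat_of_isThin ((tolerance_lt_iff _).1 htol) hk1 (by linarith)) hflat
    · rw [Real.sign_of_pos (lt_of_le_of_ne (by linarith) (sub_ne_zero.2 hne).symm)]
      exact hd

/-! ### Motions on a bounded time interval -/

/-- The motion that stands still before time `0` and after time `T`. -/
def stopAt (P : Motion n) (T : ℝ) : Motion n := fun t => P (max 0 (min t T))

variable {P : Motion n} {T : ℝ}

theorem stopAt_of_mem {t : ℝ} (ht : t ∈ Icc 0 T) : stopAt P T t = P t := by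
  rw [stopAt, min_eq_left ht.2, max_eq_right ht.1]

theorem Admissible.isSteady_stopAt (hP : Admissible P T) : IsSteady (stopAt P T) := by
  have hmem (t : ℝ) : max 0 (min t T) ∈ Icc 0 T :=
    ⟨le_max_left _ _, max_le hP.nonneg (min_le_right _ _)⟩
  refine ⟨fun i => LipschitzWith.of_dist_le_mul fun x y => ?_, fun t => hP.one_le_diameter _ (hmem t)⟩
  refine ((hP.unit_speed i).dist_le_mul _ (hmem x) _ (hmem y)).trans ?_
  gcongr
  rw [Real.dist_eq, Real.dist_eq, max_comm 0, max_comm 0]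
  exact (abs_max_sub_max_le_abs _ _ _).trans (abs_min_sub_min_le_max x T y T |>.trans (by simp))

theorem Admissible.mono (hP : Admissible P T) {t : ℝ} (ht : t ∈ Icc 0 T) : Admissible P t :=
  ⟨ht.1, fun i => (hP.unit_speed i).mono (Icc_subset_Icc_right ht.2),
    fun s hs => hP.one_le_diameter s ⟨hs.1, hs.2.trans ht.2⟩⟩

theorem Admissible.congr (hP : Admissible P T) {P' : Motion n} (h : ∀ s ∈ Icc 0 T, P s = P' s) :
    Admissible P' T :=
  ⟨hP.nonneg, fun i x hx y hy => by simpa only [h x hx, h y hy] using hP.unit_speed i hx hy,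
    fun s hs => h s hs ▸ hP.one_le_diameter s hs⟩

/-! ### Properties of the algorithm -/

/-- The algorithm that chases the orientation of a diametrical pair. -/
def chasingAlgorithm : Algorithm where
  out _ P t := open scoped Classical in
    if Admissible P t then ((chase (stopAt P t) t : ℝ) : Orientation) else 0
  causal n P P' t h := by
    by_cases hP : Admissible P t
    · have : stopAt P t = stopAt P' t := funext fun s => h _
        ⟨le_max_left _ _, max_le hP.nonneg (min_le_right _ _)⟩
      rw [if_pos hP, if_pos (hP.congr h), this]
    · rw [if_neg hP, if_neg fun hP' => hP (hP'.congr fun s hs => (h s hs).symm)]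

theorem Admissible.chasingAlgorithm_out (hP : Admissible P T) {t : ℝ} (ht : t ∈ Icc 0 T) :
    chasingAlgorithm.out n P t = ((chase (stopAt P T) t : ℝ) : Orientation) := by
  have hPt := hP.mono ht
  classical
  change (if Admissible P t then ((chase (stopAt P t) t : ℝ) : Orientation) else 0) = _
  rw [if_pos hPt, hPt.isSteady_stopAt.chase_congr hP.isSteady_stopAt ht.1 fun s hs => ?_]
  rw [stopAt_of_mem hs, stopAt_of_mem ⟨hs.1, hs.2.trans ht.2⟩]

theorem dist_coe_le (x y : ℝ) : dist (x : Orientation) (y : Orientation) ≤ |x - y| := by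
  rw [dist_eq_norm, ← AddCircle.coe_sub]
  exact QuotientAddGroup.norm_mk_le_norm

theorem isLipschitz_chasingAlgorithm : chasingAlgorithm.IsLipschitz 43 := by
  intro n P T hP
  refine LipschitzOnWith.of_dist_le_mul fun s hs t ht => ?_
  rw [hP.chasingAlgorithm_out hs, hP.chasingAlgorithm_out ht]
  exact (dist_coe_le _ _).trans (hP.isSteady_stopAt.isPursuit_chase.lipschitz.dist_le_mul s t)

theorem isChasingDiameter_chasingAlgorithm : chasingAlgorithm.IsChasingDiameter 43 := by
  intro n P T hP
  have hQ := hP.isSteady_stopAt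
  have := hQ.nonempty
  have h0 : (0 : ℝ) ∈ Icc 0 T := ⟨le_rfl, hP.nonneg⟩
  refine ⟨⟨diametricAngle (P 0), isDiametricAngle_diametricAngle _, ?_⟩, ?_⟩
  · rw [hP.chasingAlgorithm_out h0, hQ.chase_zero, stopAt_of_mem h0]
  · rw [← restrict_Ioo_eq_restrict_Icc]
    refine (ae_restrict_iff' measurableSet_Ioo).2 ?_
    filter_upwards [hQ.ae_chasesDiameterAt] with t h ht
    rw [← stopAt_of_mem (P := P) (Ioo_subset_Icc_self ht)]
    refine h ht.1 _ ?_
    filter_upwards [Ioo_mem_nhds ht.1 ht.2] with s hs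
    rw [hP.chasingAlgorithm_out (Ioo_subset_Icc_self hs)]

theorem Admissible.exists_abs_chase_sub_le (hP : Admissible P T) {t θ : ℝ} (ht : t ∈ Icc 0 T)
    (hthin : IsThin (P t) θ) : ∃ m : ℤ, |chase (stopAt P T) t - (θ + m * Real.pi)| ≤
      Real.arcsin (aspectRatio (P t) θ) := by
  rw [← stopAt_of_mem (P := P) ht] at hthin ⊢
  obtain ⟨m, h, -⟩ := hP.isSteady_stopAt.exists_abs_chase_sub_le ht.1 hthin
  exact ⟨m, h⟩

theorem staysWithinTolerance_chasingAlgorithm : chasingAlgorithm.StaysWithinTolerance := by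
  intro n P T hP t ht θ _
  rw [hP.chasingAlgorithm_out ht]
  by_cases hthin : IsThin (P t) θ
  · obtain ⟨m, hm⟩ := hP.exists_abs_chase_sub_le ht hthin
    have hD : 0 < diameter (P t) := zero_lt_one.trans_le (hP.one_le_diameter t ht)
    have hA0 := Real.arcsin_nonneg.2 (aspectRatio_nonneg hD θ)
    have e : ((θ + m * Real.pi : ℝ) : Orientation) = (θ : Orientation) := by
      rw [← zsmul_eq_mul, AddCircle.coe_add, AddCircle.coe_zsmul, AddCircle.coe_period, smul_zero,
        add_zero]
    rw [← e]
    refine (dist_coe_le _ _).trans (hm.trans ?_)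
    rw [tolerance]
    linarith
  · have h : Real.pi / 2 ≤ tolerance (aspectRatio (P t) θ) :=
      not_lt.1 fun h => hthin ((tolerance_lt_iff _).1 h)
    refine le_trans ?_ h
    rw [dist_eq_norm]
    have := AddCircle.norm_le_half_period Real.pi Real.pi_ne_zero
      (x := ((chase (stopAt P T) t : ℝ) : Orientation) - (θ : Orientation))
    rwa [abs_of_pos Real.pi_pos] at this

/-- A pointwise bound between costs bounds the ratio, also where the minimum cost is `0`. -/
theorem Algorithm.ratio_le {A : Algorithm} {f : CostFunction}
    (h : ∀ (n : ℕ) (P : Motion n) (T : ℝ), Admissible P T → ∀ t ∈ Icc 0 T, ∀ φ : ℝ,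
      f n (A.out n P t) (P t) ≤ 18 * f n (φ : Orientation) (P t)) : A.ratio f ≤ 18 := by
  refine iSup_le fun n => iSup_le fun P => iSup_le fun T => iSup_le fun hP => iSup_le fun t =>
    iSup_le fun ht => ENNReal.div_le_of_le_mul ?_
  rw [ENNReal.mul_iInf_of_ne (by simp) (by simp)]
  refine le_iInf fun γ => ?_
  induction γ using QuotientAddGroup.induction_on with
  | H φ =>
    rw [← ENNReal.ofReal_ofNat, ← ENNReal.ofReal_mul (by norm_num)]
    exact ENNReal.ofReal_le_ofReal (h n P T hP t ht φ)

theorem ratio_stripCost_chasingAlgorithm : chasingAlgorithm.ratio stripCost ≤ 18 := by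
  refine Algorithm.ratio_le fun n P T hP t ht φ => ?_
  have hD : 0 < diameter (P t) := zero_lt_one.trans_le (hP.one_le_diameter t ht)
  have := nonempty_of_diameter_pos hD
  rw [hP.chasingAlgorithm_out ht, stripCost, stripCost, perp_coe, perp_coe, extent_coe, extent_coe]
  exact (isDiametricAngle_diametricAngle (P t)).strip_le hD
    (fun h => hP.exists_abs_chase_sub_le ht h) _

theorem ratio_obbCost_chasingAlgorithm : chasingAlgorithm.ratio obbCost ≤ 18 := by
  refine Algorithm.ratio_le fun n P T hP t ht φ => ?_
  have hD : 0 < diameter (P t) := zero_lt_one.trans_le (hP.one_le_diameter t ht)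
  have := nonempty_of_diameter_pos hD
  rw [hP.chasingAlgorithm_out ht, obbCost, obbCost, perp_coe, perp_coe, extent_coe, extent_coe,
    extent_coe, extent_coe]
  exact (isDiametricAngle_diametricAngle (P t)).obb_le hD
    (fun h => hP.exists_abs_chase_sub_le ht h) _

end OrientationStability

end

theorem theorem3 :
    (∃ A : OrientationStability.Algorithm,
      A.IsLipschitz 43 ∧ A.IsChasingDiameter 43 ∧ A.StaysWithinTolerance ∧
      A.ratio OrientationStability.obbCost ≤ 18 ∧
      A.ratio OrientationStability.stripCost ≤ 18) ∧
    OrientationStability.lipschitzStabilityRatio OrientationStability.obbCost 43 ≤ 18 ∧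
    OrientationStability.lipschitzStabilityRatio OrientationStability.stripCost 43 ≤ 18 := by
  refine ⟨⟨OrientationStability.chasingAlgorithm,
    OrientationStability.isLipschitz_chasingAlgorithm,
    OrientationStability.isChasingDiameter_chasingAlgorithm,
    OrientationStability.staysWithinTolerance_chasingAlgorithm,
    OrientationStability.ratio_obbCost_chasingAlgorithm,
    OrientationStability.ratio_stripCost_chasingAlgorithm⟩, ?_, ?_⟩
  · exact iInf₂_le_of_le _ OrientationStability.isLipschitz_chasingAlgorithm
      OrientationStability.ratio_obbCost_chasingAlgorithm
  · exact iInf₂_le_of_le _ OrientationStability.isLipschitz_chasingAlgorithm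
      OrientationStability.ratio_stripCost_chasingAlgorithm
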